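/- **Theorem (scattering on the Poincaré ball).** Let $n\ge 1$ be an integer, $\gamma\in(0,\infty)\setminus\mathbb N$ and $s=\frac n2+\gamma$. Let $\Delta_+$ be the Laplace–Beltrami operator of the Poincaré metric $g=\frac{4|dx|^2}{(1-|x|^2)^2}$ on the open unit ball $\mathbb B^{n+1}\subset\mathbb R^{n+1}$, and let $\rho_0=\frac{1-|x|^2}{2}$. For every real-valued $f\in C(\mathbb S^n)$ there is a unique $u\in C^2(\mathbb B^{n+1})$ such that $$-\Delta_+u-s(n-s)u=0\quad\text{in }\mathbb B^{n+1},\qquad \lim_{\rho_0\to0^+}\rho_0^{\,s-n}u=f\quad\text{on }\mathbb S^n,$$ where the limit means that $\rho_0(r\xi)^{s-n}u(r\xi)\to f(\xi)$ as $r\to1^-$, uniformly in $\xi\in\mathbb S^n$. It is given, for all $x\in\mathbb B^{n+1}$, by $$u(x)=\pi^{-\frac n2}\,\frac{2^{-s}\,\Gamma(\frac n2+\gamma)}{\Gamma(\gamma)}\int_{\mathbb S^n}\left(\frac{1-|x|^2}{|x-\xi|^2}\right)^{s}f(\xi)\,dV_{\mathbb S^n}(\xi),$$ with $dV_{\mathbb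 S^n}$ the surface measure. Furthermore, let $\mathscr H_l$ be the space of spherical harmonics of degree $l$ (restrictions to $\mathbb S^n$ of homogeneous harmonic polynomials of degree $l$ on $\mathbb R^{n+1}$). If $f=\sum_{l=0}^\infty Y_l$ in $L^2(\mathbb S^n)$ with $Y_l\in\mathscr H_l$, then for all $r\in[0,1)$ and $\xi\in\mathbb S^n$ $$u(r\xi)=\rho_0(r\xi)^{n-s}\sum_{l=0}^\infty\varphi_l(r^2)\,r^l\,Y_l(\xi),$$ where the series converges absolutely and, for $l\ge0$ and $t\in[0,1]$, $$\varphi_l(t)=\frac{F(l+\frac n2-\gamma,\frac12-\gamma;l+\frac{n+1}2;t)}{F(l+\frac n2-\gamma,\frac12-\gamma;l+\frac{n+1}2;1)}=\frac{\Gamma(\gamma+\frac12)}{\Gamma(2\gamma)}\,\frac{\Gamma(l+\gamma+\frac n2)}{\Gamma(l+\frac{n+1}2)}\,F\!\left(l+\tfrac n2-\gamma,\tfrac12-\gamma;l+\tfrac{n+1}2;t\right),$$ with $F(a,b;c;z)=\sum_{k\ge0}\frac{(a)_k(b)_k}{(c)_k}\frac{z^k}{k!}$ the Gauss hypergeometric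 function. -/

import Mathlib

open Set Filter Topology MeasureTheory

noncomputable section

/-- Euclidean space `ℝ^{n+1}` with its Euclidean norm. -/
abbrev RSpace (n : ℕ) : Type := EuclideanSpace ℝ (Fin (n + 1))

/-- The open unit ball `𝔹^{n+1}`. -/
def unitBall (n : ℕ) : Set (RSpace n) := Metric.ball 0 1

/-- The unit sphere `𝕊^n` in `ℝ^{n+1}`. -/
abbrev UnitSphere (n : ℕ) : Type := Metric.sphere (0 : RSpace n) 1

/-- The surface measure of `𝕊^n`. -/
def surfaceMeasure (n : ℕ) : Measure (UnitSphere n) :=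
  (volume : Measure (RSpace n)).toSphere

/-- The `i`-th partial derivative `∂_i v`. -/
def partialDeriv {n : ℕ} (i : Fin (n + 1)) (v : RSpace n → ℝ) (x : RSpace n) : ℝ :=
  fderiv ℝ v x (EuclideanSpace.single i (1 : ℝ))

/-- The Laplace-Beltrami operator of a Riemannian metric given by its matrix `g = (g_{ij})` in the
standard coordinates: `(det g)^{-1/2} ∑_i ∂_i ((det g)^{1/2} ∑_j g^{ij} ∂_j u)`. -/
def laplaceBeltrami {n : ℕ} (g : RSpace n → Matrix (Fin (n + 1)) (Fin (n + 1)) ℝ)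
    (u : RSpace n → ℝ) (x : RSpace n) : ℝ :=
  (Real.sqrt (g x).det)⁻¹ *
    ∑ i, partialDeriv i
      (fun y => Real.sqrt (g y).det * ∑ j, (g y)⁻¹ i j * partialDeriv j u y) x

/-- The Poincaré metric `4 |dx|² / (1 - |x|²)²`. -/
def poincareMetric (n : ℕ) (x : RSpace n) : Matrix (Fin (n + 1)) (Fin (n + 1)) ℝ :=
  (4 / (1 - ‖x‖ ^ 2) ^ 2) • (1 : Matrix (Fin (n + 1)) (Fin (n + 1)) ℝ)

/-- The flat defining function `ρ₀ = (1 - |x|²) / 2`. -/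
def flatDefining {n : ℕ} (x : RSpace n) : ℝ := (1 - ‖x‖ ^ 2) / 2

/-- `u ∈ C²(𝔹^{n+1})` solves `-Δ₊ u - s (n - s) u = 0` in the ball, with `ρ₀^{s-n} u → f`
uniformly on the sphere as `ρ₀ → 0⁺`, that is, along `x = r ξ` with `r → 1⁻`. -/
structure IsPoissonSolution (n : ℕ) (s : ℝ) (f : UnitSphere n → ℝ) (u : RSpace n → ℝ) : Prop where
  contDiffOn : ContDiffOn ℝ 2 u (unitBall n)
  equation : ∀ x ∈ unitBall n,
    -laplaceBeltrami (poincareMetric n) u x - s * ((n : ℝ) - s) * u x = 0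
  boundary : TendstoUniformly
    (fun (r : ℝ) (ξ : UnitSphere n) =>
      flatDefining (r • (ξ : RSpace n)) ^ (s - (n : ℝ)) * u (r • (ξ : RSpace n)))
    f (𝓝[<] (1 : ℝ))

/-- `Y ∈ ℋ_l`: the function `Y` on `𝕊^n` is the restriction of a homogeneous harmonic polynomial of
degree `l` in `n + 1` variables. -/
def IsSphericalHarmonic (n l : ℕ) (Y : UnitSphere n → ℝ) : Prop :=
  ∃ p : MvPolynomial (Fin (n + 1)) ℝ, p.IsHomogeneous l ∧
    ∑ i, MvPolynomial.pderiv i (MvPolynomial.pderiv i p) = 0 ∧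
    ∀ ξ : UnitSphere n, Y ξ = MvPolynomial.eval (fun i => (ξ : RSpace n) i) p

/-- `f = ∑_l Y_l` is a spherical harmonic expansion: `Y_l ∈ ℋ_l` and the partial sums converge to
`f` in `L²(𝕊^n)`. -/
structure IsHarmonicExpansion (n : ℕ) (f : UnitSphere n → ℝ) (Y : ℕ → UnitSphere n → ℝ) :
    Prop where
  mem : ∀ l, IsSphericalHarmonic n l (Y l)
  tendsto : Tendsto
    (fun N : ℕ => ∫ ξ, (f ξ - ∑ l ∈ Finset.range N, Y l ξ) ^ 2 ∂(surfaceMeasure n))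
    atTop (𝓝 0)

/-- The function `F(l + n/2 - γ, 1/2 - γ; l + (n+1)/2; t)`. -/
def radialHypergeometric (n : ℕ) (γ : ℝ) (l : ℕ) (t : ℝ) : ℝ :=
  ordinaryHypergeometric ((l : ℝ) + (n : ℝ) / 2 - γ) (1 / 2 - γ) ((l : ℝ) + ((n : ℝ) + 1) / 2) t

/-- The radial profile `φ_l`. -/
def radialProfile (n : ℕ) (γ : ℝ) (l : ℕ) (t : ℝ) : ℝ :=
  radialHypergeometric n γ l t / radialHypergeometric n γ l 1

end

/-! On functions of class C² the Laplace-Beltrami operator is `ρ₀² Δ + (n - 1) ρ₀ x·∇`. A direct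
computation shows that `((1 - |x|²)/|x - ξ|²)^s` solves the equation for each `ξ` on the sphere
(`hyperbolicLaplacian_poissonKernel`), and differentiating under the integral sign makes every
Poisson integral a solution.

The zero-order term has no fixed sign, so the maximum principle is applied to quotients. Since `s(n
- s) = n²/4 - γ²`, a positive solution plus `(1 - |x|²)^{n/2}` is a positive strict supersolution
`Q`, and `v/Q` cannot have a positive interior maximum when `v` is a solution. This gives the
comparison principle `IsBallSolution.le_of_le_on_sphere`.

The Poisson integral of `1` is radial by rotation invariance. Comparison identifies it with a
multiple of the separated solution `(1 - |x|²)^{n/2-γ} F_0(|x|²)` (`poissonMass_eq_radialSolution`).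
Gauss' summation formula evaluates `F_0(1)`, and the duplication formula for Gamma turns this into
the normalizing constant. The normalized kernel is then an approximate identity after multiplication
by `ρ₀^{s-n}`, which gives the boundary values. Uniqueness follows by comparing a difference of two
solutions with `M Q` and letting `M → 0`: `ρ₀^{s-n} Q` stays bounded away from zero at the boundary.

For a spherical harmonic, separation of variables produces a solution through the hypergeometric
equation, and uniqueness says that it is the Poisson integral (`poissonSolution_sphericalHarmonic`).
Evaluation of the Poisson integral at an interior point is continuous in `L²` by Cauchy-Schwarz, so
the `L²` expansion of `f` passes to a pointwise expansion of `u`. Absolute convergence at radius `r`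
comes from boundedness of the terms at some radius `q > r`: passing from `q` to `r` gains `(r/q)^l`,
and the ratios of the hypergeometric factors stay bounded in `l`. -/

noncomputable section

/-! ### The Gauss hypergeometric series -/

/-- The Taylor coefficients `(a)_k (b)_k / ((c)_k k!)` of the Gauss hypergeometric function. -/
def gaussCoeff (a b c : ℝ) (k : ℕ) : ℝ := ordinaryHypergeometricCoefficient a b c k

theorem ascPochhammer_eval_pos_of_pos {c : ℝ} (hc : 0 < c) (k : ℕ) :
    0 < (ascPochhammer ℝ k).eval c := ascPochhammer_pos k c hc

theorem gaussCoeff_zero (a b c : ℝ) : gaussCoeff a b c 0 = 1 := by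
  simp [gaussCoeff, ordinaryHypergeometricCoefficient]

theorem gaussCoeff_succ (a b : ℝ) {c : ℝ} (hc : 0 < c) (k : ℕ) :
    ((k : ℝ) + 1) * (c + k) * gaussCoeff a b c (k + 1) = (a + k) * (b + k) * gaussCoeff a b c k := by
  have h1 := (ascPochhammer_eval_pos_of_pos hc k).ne'
  have h2 : c + k ≠ 0 := by positivity
  have h3 : ((k.factorial : ℕ) : ℝ) ≠ 0 := by positivity
  have h4 : ((k : ℝ) + 1) ≠ 0 := by positivity
  simp only [gaussCoeff, ordinaryHypergeometricCoefficient, ascPochhammer_succ_eval,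
    Nat.factorial_succ, Nat.cast_mul, Nat.cast_add, Nat.cast_one]
  field_simp

theorem ordinaryHypergeometric_eq_tsum_gaussCoeff (a b c t : ℝ) :
    ordinaryHypergeometric a b c t = ∑' k, gaussCoeff a b c k * t ^ k := by
  rw [ordinaryHypergeometric_eq_tsum]
  rfl

/-- Raabe-type estimate: `k |u_k|` decreases by a fixed multiple of `|u_k|`. -/
theorem gaussCoeff_eventually_decrease (a b : ℝ) {c : ℝ} (hc : 0 < c) (h : 0 < c - a - b) :
    ∃ K : ℕ, ∀ k ≥ K, (c - a - b) / 2 * |gaussCoeff a b c k| ≤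
      k * |gaussCoeff a b c k| - ((k + 1 : ℕ) : ℝ) * |gaussCoeff a b c (k + 1)| := by
  -- With `δ = (c - a - b)/2`, the claim is `(a + k)(b + k) ≤ (k - δ)(c + k)`, in which `k²` cancels
  -- and `a b + δ c ≤ δ k` remains; this is the third bound on `K`. The first two make `a + k` and
  -- `b + k` nonnegative, so that absolute values pass through the recurrence.
  obtain ⟨K, hK⟩ := exists_nat_ge
    (max (max (-a) (-b)) ((a * b + (c - a - b) / 2 * c) / ((c - a - b) / 2)))
  refine ⟨K, fun k hk => ?_⟩
  have hk' : (K : ℝ) ≤ k := by exact_mod_cast hk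
  have ha : 0 ≤ a + k := by
    have := le_trans (le_trans (le_max_left _ _) (le_max_left _ _)) hK
    linarith
  have hb : 0 ≤ b + k := by
    have := le_trans (le_trans (le_max_right _ _) (le_max_left _ _)) hK
    linarith
  have hk3 : a * b + (c - a - b) / 2 * c ≤ k * ((c - a - b) / 2) := by
    have := (le_trans (le_max_right _ _) hK).trans hk'
    rwa [div_le_iff₀ (by linarith)] at this
  have hck : 0 < c + k := by positivity
  have e := gaussCoeff_succ a b hc k
  have e' : ((k : ℝ) + 1) * |gaussCoeff a b c (k + 1)| =
      (a + k) * (b + k) / (c + k) * |gaussCoeff a b c k| := by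
    have := congrArg abs e
    rw [abs_mul, abs_mul, abs_mul, abs_mul, abs_of_nonneg ha, abs_of_nonneg hb, abs_of_pos hck,
      abs_of_nonneg (by positivity : (0 : ℝ) ≤ (k : ℝ) + 1)] at this
    field_simp
    linarith
  push_cast
  rw [e', ← sub_mul]
  refine mul_le_mul_of_nonneg_right ?_ (abs_nonneg _)
  rw [le_sub_iff_add_le, ← le_sub_iff_add_le', div_le_iff₀ hck]
  nlinarith

/-- The right side of the Raabe estimate telescopes, which bounds the partial sums from index `K`
on. This gives convergence at the endpoint `t = 1`, where the ratio test decides nothing. -/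
theorem summable_abs_gaussCoeff (a b : ℝ) {c : ℝ} (hc : 0 < c) (h : 0 < c - a - b) :
    Summable fun k => |gaussCoeff a b c k| := by
  obtain ⟨K, hK⟩ := gaussCoeff_eventually_decrease a b hc h
  rw [← summable_nat_add_iff K]
  have hδ : 0 < (c - a - b) / 2 := by linarith
  refine summable_of_sum_range_le (c := (K : ℝ) * |gaussCoeff a b c K| / ((c - a - b) / 2))
    (fun k => abs_nonneg _) (fun m => ?_)
  rw [le_div_iff₀ hδ, Finset.sum_mul]
  have key : ∑ i ∈ Finset.range m, |gaussCoeff a b c (i + K)| * ((c - a - b) / 2) ≤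
      ∑ i ∈ Finset.range m, (((i + K : ℕ) : ℝ) * |gaussCoeff a b c (i + K)| -
        ((i + 1 + K : ℕ) : ℝ) * |gaussCoeff a b c (i + 1 + K)|) := by
    refine Finset.sum_le_sum fun i _ => ?_
    have := hK (i + K) (by omega)
    rw [mul_comm, show i + 1 + K = i + K + 1 by ring]
    exact this
  rw [Finset.sum_range_sub' (fun i => ((i + K : ℕ) : ℝ) * |gaussCoeff a b c (i + K)|)] at key
  simp only [zero_add] at key
  have : 0 ≤ ((m + K : ℕ) : ℝ) * |gaussCoeff a b c (m + K)| := by positivity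
  linarith

/-- By the Raabe estimate `k |u_k|` is eventually decreasing, so it has a limit `L ≥ 0`. If `L > 0`,
then `|u_k| ≥ L/k` eventually, and summability of `u` would make the harmonic series converge. -/
theorem tendsto_natCast_mul_gaussCoeff (a b : ℝ) {c : ℝ} (hc : 0 < c) (h : 0 < c - a - b) :
    Tendsto (fun k : ℕ => (k : ℝ) * gaussCoeff a b c k) atTop (𝓝 0) := by
  obtain ⟨K, hK⟩ := gaussCoeff_eventually_decrease a b hc h
  have hδ : 0 < (c - a - b) / 2 := by linarith
  set w : ℕ → ℝ := fun k => ((k + K : ℕ) : ℝ) * |gaussCoeff a b c (k + K)| with hw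
  have hanti : Antitone w := antitone_nat_of_succ_le fun k => by
    have := hK (k + K) (by omega)
    have h0 : 0 ≤ (c - a - b) / 2 * |gaussCoeff a b c (k + K)| := by positivity
    simp only [hw]
    rw [show k + 1 + K = k + K + 1 by ring]
    linarith
  have hw0 : ∀ k, 0 ≤ w k := fun k => by simp only [hw]; positivity
  have hbdd : BddBelow (range w) := ⟨0, by rintro _ ⟨k, rfl⟩; exact hw0 k⟩
  have hlim := tendsto_atTop_ciInf hanti hbdd
  set L := ⨅ i, w i with hL
  have hL0 : 0 ≤ L := le_ciInf hw0
  have hLle : ∀ k, L ≤ w k := fun k => ciInf_le hbdd k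
  have hLz : L = 0 := by
    by_contra hne
    have hLpos : 0 < L := lt_of_le_of_ne hL0 (Ne.symm hne)
    have hs := (summable_nat_add_iff (K + 1)).2 (summable_abs_gaussCoeff a b hc h)
    have hs2 : Summable fun k : ℕ => 1 / ((k + (K + 1) : ℕ) : ℝ) := by
      refine Summable.of_nonneg_of_le (fun k => by positivity) (fun k => ?_) (hs.mul_left (1 / L))
      have h1 := hLle (k + 1)
      simp only [hw] at h1
      rw [show k + 1 + K = k + (K + 1) by ring] at h1
      have h2 : (0 : ℝ) < ((k + (K + 1) : ℕ) : ℝ) := by positivity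
      rw [div_mul_eq_mul_div, one_mul, div_le_div_iff₀ h2 hLpos, one_mul, mul_comm]
      exact h1
    exact Real.not_summable_one_div_natCast ((summable_nat_add_iff (K + 1)).1 hs2)
  rw [hLz] at hlim
  have h1 : Tendsto (fun k : ℕ => (k : ℝ) * |gaussCoeff a b c k|) atTop (𝓝 0) :=
    (tendsto_add_atTop_iff_nat K).1 hlim
  refine (tendsto_zero_iff_abs_tendsto_zero _).2 (h1.congr fun k => ?_)
  simp [Function.comp, abs_mul]

theorem summable_gaussCoeff (a b : ℝ) {c : ℝ} (hc : 0 < c) (h : 0 < c - a - b) :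
    Summable fun k => gaussCoeff a b c k := (summable_abs_gaussCoeff a b hc h).of_abs

theorem gaussCoeff_add_one_right (a b : ℝ) {c : ℝ} (hc : 0 < c) (k : ℕ) :
    (c + k) * gaussCoeff a b (c + 1) k = c * gaussCoeff a b c k := by
  induction k with
  | zero => simp [gaussCoeff_zero]
  | succ k ih =>
    have h1 := gaussCoeff_succ a b hc k
    have h2 := gaussCoeff_succ a b (by linarith : 0 < c + 1) k
    have hk : (0 : ℝ) < (k : ℝ) + 1 := by positivity
    have hck : 0 < c + k := by positivity
    push_cast
    have : ((k : ℝ) + 1) * (c + k) * ((c + (k + 1)) * gaussCoeff a b (c + 1) (k + 1)) =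
        ((k : ℝ) + 1) * (c + k) * (c * gaussCoeff a b c (k + 1)) := by
      linear_combination (c + k) * h2 + (a + k) * (b + k) * ih - c * h1
    exact mul_left_cancel₀ (by positivity) this

/-- The contiguous relation between `F(a,b;c;1)` and `F(a,b;c+1;1)`. -/
theorem tsum_gaussCoeff_contiguous (a b : ℝ) {c : ℝ} (hc : 0 < c) (h : 0 < c - a - b) :
    c * (c - a - b) * ∑' k, gaussCoeff a b c k =
      (c - a) * (c - b) * ∑' k, gaussCoeff a b (c + 1) k := by
  have hs1 := summable_gaussCoeff a b hc h
  have hs2 := summable_gaussCoeff a b (by linarith : 0 < c + 1) (by linarith)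
  -- The difference of the two series telescopes term by term; its boundary term is a multiple of `k
  -- u_k`, which tends to zero.
  have hterm : ∀ k : ℕ, c * (c - a - b) * gaussCoeff a b c k -
      (c - a) * (c - b) * gaussCoeff a b (c + 1) k =
      c * (k * gaussCoeff a b c k - ((k + 1 : ℕ) : ℝ) * gaussCoeff a b c (k + 1)) := by
    intro k
    have hck : 0 < c + k := by positivity
    have e1 := gaussCoeff_succ a b hc k
    have e2 := gaussCoeff_add_one_right a b hc k
    refine mul_left_cancel₀ hck.ne' ?_
    push_cast
    linear_combination c * e1 - (c - a) * (c - b) * e2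
  have hsum := ((hs1.hasSum.mul_left (c * (c - a - b))).sub
    (hs2.hasSum.mul_left ((c - a) * (c - b)))).tendsto_sum_nat
  have hz : Tendsto (fun m => ∑ k ∈ Finset.range m, (c * (c - a - b) * gaussCoeff a b c k -
      (c - a) * (c - b) * gaussCoeff a b (c + 1) k)) atTop (𝓝 0) := by
    simp_rw [hterm, ← Finset.mul_sum,
      Finset.sum_range_sub' (fun k : ℕ => (k : ℝ) * gaussCoeff a b c k)]
    have := ((tendsto_natCast_mul_gaussCoeff a b hc h).const_sub
      (((0 : ℕ) : ℝ) * gaussCoeff a b c 0)).const_mul c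
    simpa using this
  have := tendsto_nhds_unique hsum hz
  linarith

/-- Iterating the contiguous relation pushes the third parameter to `c + m`, at the price of finite
products that become Gamma functions in the limit. -/
theorem tsum_gaussCoeff_eq_prod (a b : ℝ) {c : ℝ} (hc : 0 < c) (h : 0 < c - a - b) (m : ℕ) :
    (∏ j ∈ Finset.range m, (c + j)) * (∏ j ∈ Finset.range m, (c - a - b + j)) *
        ∑' k, gaussCoeff a b c k =
      (∏ j ∈ Finset.range m, (c - a + j)) * (∏ j ∈ Finset.range m, (c - b + j)) *
        ∑' k, gaussCoeff a b (c + m) k := by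
  induction m with
  | zero => simp
  | succ m ih =>
    have := tsum_gaussCoeff_contiguous a b (c := c + m) (by positivity)
      (by have : (0 : ℝ) ≤ m := by positivity
          linarith)
    rw [Finset.prod_range_succ, Finset.prod_range_succ, Finset.prod_range_succ,
      Finset.prod_range_succ]
    push_cast
    rw [← add_assoc]
    linear_combination (c + m) * (c - a - b + m) * ih + (∏ j ∈ Finset.range m, (c - a + j)) *
      (∏ j ∈ Finset.range m, (c - b + j)) * this

theorem ascPochhammer_eval_mono {c d : ℝ} (hc : 0 < c) (hcd : c ≤ d) (k : ℕ) :
    (ascPochhammer ℝ k).eval c ≤ (ascPochhammer ℝ k).eval d := by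
  induction k with
  | zero => simp
  | succ k ih =>
    rw [ascPochhammer_succ_eval, ascPochhammer_succ_eval]
    have := ascPochhammer_eval_pos_of_pos hc k
    have := ascPochhammer_eval_pos_of_pos (hc.trans_le hcd) k
    gcongr

/-- For `k ≥ 1` the denominator `(c + m)_k` tends to infinity, so only the term `k = 0` survives.
Monotonicity of `(c)_k` in `c` makes the coefficients at `m = 0` a summable majorant. -/
theorem tendsto_tsum_gaussCoeff_add_natCast (a b : ℝ) {c : ℝ} (hc : 0 < c) (h : 0 < c - a - b) :
    Tendsto (fun m : ℕ => ∑' k, gaussCoeff a b (c + m) k) atTop (𝓝 1) := by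
  have h1 : ∑' k : ℕ, (if k = 0 then (1 : ℝ) else 0) = 1 := by simp
  rw [← h1]
  refine tendsto_tsum_of_dominated_convergence (summable_abs_gaussCoeff a b hc h) ?_ ?_
  · intro k
    rcases k with _ | k
    · simp [gaussCoeff_zero]
    · rw [if_neg (by omega)]
      have hpoch : Tendsto (fun m : ℕ => (ascPochhammer ℝ (k + 1)).eval (c + m)) atTop atTop := by
        refine tendsto_atTop_mono' _ (f₁ := fun m : ℕ => (c + m) * (ascPochhammer ℝ k).eval (c + 1))
          ?_ ?_
        · filter_upwards [eventually_ge_atTop 1] with m hm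
          have hm' : (1 : ℝ) ≤ m := by exact_mod_cast hm
          rw [ascPochhammer_succ_left, Polynomial.eval_mul, Polynomial.eval_X,
            Polynomial.eval_comp]
          simp only [Polynomial.eval_add, Polynomial.eval_X, Polynomial.eval_one]
          have := ascPochhammer_eval_mono (c := c + 1) (d := c + m + 1) (by linarith)
            (by linarith) k
          gcongr
        · exact (tendsto_atTop_add_const_left _ c tendsto_natCast_atTop_atTop).atTop_mul_const
            (ascPochhammer_eval_pos_of_pos (by linarith) k)
      simpa [gaussCoeff, ordinaryHypergeometricCoefficient] using
        (tendsto_inv_atTop_zero.comp hpoch).const_mul ((((k + 1).factorial : ℕ) : ℝ)⁻¹ *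
          (ascPochhammer ℝ (k + 1)).eval a * (ascPochhammer ℝ (k + 1)).eval b)
  · refine Eventually.of_forall fun m k => ?_
    have hp := ascPochhammer_eval_pos_of_pos hc k
    have hm : c ≤ c + m := by linarith [(Nat.cast_nonneg m : (0 : ℝ) ≤ m)]
    have := ascPochhammer_eval_mono hc hm k
    simp only [gaussCoeff, ordinaryHypergeometricCoefficient, Real.norm_eq_abs]
    rw [abs_mul, abs_mul _ ((Polynomial.eval c (ascPochhammer ℝ k))⁻¹), abs_inv, abs_inv,
      abs_of_pos hp, abs_of_pos (hp.trans_le this)]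
    gcongr

theorem prod_range_succ_add_eq_div_gammaSeq {x : ℝ} (hx : 0 < x) {m : ℕ} (hm : 0 < m) :
    ∏ j ∈ Finset.range (m + 1), (x + j) = (m : ℝ) ^ x * m.factorial / Real.GammaSeq x m := by
  have h1 : ∏ j ∈ Finset.range (m + 1), (x + (j : ℝ)) ≠ 0 :=
    (Finset.prod_pos fun j _ => by positivity).ne'
  have h2 : (m : ℝ) ^ x ≠ 0 := (Real.rpow_pos_of_pos (by exact_mod_cast hm) x).ne'
  have h3 : ((m.factorial : ℕ) : ℝ) ≠ 0 := by positivity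
  rw [Real.GammaSeq]
  field_simp

/-- Gauss' summation formula. -/
theorem tsum_gaussCoeff_eq_gamma {a b c : ℝ} (hc : 0 < c) (h : 0 < c - a - b) (ha : 0 < c - a)
    (hb : 0 < c - b) : ∑' k, gaussCoeff a b c k =
      Real.Gamma c * Real.Gamma (c - a - b) / (Real.Gamma (c - a) * Real.Gamma (c - b)) := by
  have hlim1 : Tendsto (fun m : ℕ => Real.GammaSeq (c - a) m * Real.GammaSeq (c - b) m *
      ∑' k, gaussCoeff a b c k) atTop (𝓝 (Real.Gamma (c - a) * Real.Gamma (c - b) *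
        ∑' k, gaussCoeff a b c k)) :=
    ((Real.GammaSeq_tendsto_Gamma _).mul (Real.GammaSeq_tendsto_Gamma _)).mul_const _
  have hlim2 : Tendsto (fun m : ℕ => Real.GammaSeq c m * Real.GammaSeq (c - a - b) m *
      ∑' k, gaussCoeff a b (c + (m + 1 : ℕ)) k) atTop (𝓝 (Real.Gamma c * Real.Gamma (c - a - b) *
        1)) :=
    ((Real.GammaSeq_tendsto_Gamma _).mul (Real.GammaSeq_tendsto_Gamma _)).mul
      ((tendsto_add_atTop_iff_nat 1).2 (tendsto_tsum_gaussCoeff_add_natCast a b hc h))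
  have heq : (fun m : ℕ => Real.GammaSeq c m * Real.GammaSeq (c - a - b) m *
      ∑' k, gaussCoeff a b (c + (m + 1 : ℕ)) k) =ᶠ[atTop] fun m : ℕ =>
      Real.GammaSeq (c - a) m * Real.GammaSeq (c - b) m * ∑' k, gaussCoeff a b c k := by
    filter_upwards [eventually_gt_atTop 0] with m hm
    have hm' : (0 : ℝ) < m := by exact_mod_cast hm
    have hseq : ∀ {x : ℝ}, 0 < x → Real.GammaSeq x m ≠ 0 := fun {x} hx => by
      have : 0 < ∏ j ∈ Finset.range (m + 1), (x + (j : ℝ)) :=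
        Finset.prod_pos fun j _ => by positivity
      rw [Real.GammaSeq]
      positivity
    -- `GammaSeq x m` contains `m + 1` linear factors, hence `m + 1` iterations. The factorials
    -- cancel, and so do the powers of `m`, because `(c - a) + (c - b) = c + (c - a - b)`.
    have e := tsum_gaussCoeff_eq_prod a b hc h (m + 1)
    rw [prod_range_succ_add_eq_div_gammaSeq hc hm, prod_range_succ_add_eq_div_gammaSeq h hm,
      prod_range_succ_add_eq_div_gammaSeq ha hm, prod_range_succ_add_eq_div_gammaSeq hb hm] at e
    have h1 := hseq hc
    have h2 := hseq h
    have h3 := hseq ha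
    have h4 := hseq hb
    have hpow : (m : ℝ) ^ (c - a) * (m : ℝ) ^ (c - b) = (m : ℝ) ^ c * (m : ℝ) ^ (c - a - b) := by
      rw [← Real.rpow_add hm', ← Real.rpow_add hm']
      ring_nf
    have h5 : (m : ℝ) ^ c * (m : ℝ) ^ (c - a - b) ≠ 0 := by positivity
    have h6 : ((m.factorial : ℕ) : ℝ) ≠ 0 := by positivity
    field_simp at e
    have e2 : ((m : ℝ) ^ c * (m : ℝ) ^ (c - a - b)) * (Real.GammaSeq c m *
        Real.GammaSeq (c - a - b) m * ∑' k, gaussCoeff a b (c + (m + 1 : ℕ)) k) =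
        ((m : ℝ) ^ c * (m : ℝ) ^ (c - a - b)) * (Real.GammaSeq (c - a) m *
        Real.GammaSeq (c - b) m * ∑' k, gaussCoeff a b c k) := by
      linear_combination (-1) * e - Real.GammaSeq c m *
        Real.GammaSeq (c - a - b) m * (∑' k, gaussCoeff a b (c + (m + 1 : ℕ)) k) * hpow
    exact mul_left_cancel₀ h5 e2
  have := tendsto_nhds_unique (hlim2.congr' heq) hlim1
  have g1 := Real.Gamma_pos_of_pos ha
  have g2 := Real.Gamma_pos_of_pos hb
  field_simp
  linarith
end

noncomputable section

/-! ### Power series with radius of convergence at least one -/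

/-- The series `∑ c_k t^k` converges absolutely for `|t| < 1`. -/
def UnitDiscSummable (c : ℕ → ℝ) : Prop := ∀ r : ℝ, 0 ≤ r → r < 1 → Summable fun k => |c k| * r ^ k

theorem UnitDiscSummable.of_summable_abs {c : ℕ → ℝ} (hc : Summable fun k => |c k|) :
    UnitDiscSummable c := fun r h0 h1 =>
  Summable.of_nonneg_of_le (fun k => by positivity)
    (fun k => mul_le_of_le_one_right (abs_nonneg _) (pow_le_one₀ h0 h1.le)) hc

theorem UnitDiscSummable.summable {c : ℕ → ℝ} (hc : UnitDiscSummable c) {t : ℝ} (ht : |t| < 1) :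
    Summable fun k => c k * t ^ k := by
  refine Summable.of_norm ?_
  simpa [abs_mul] using hc |t| (abs_nonneg t) ht

/-- The coefficients of the derived power series. -/
def derivedCoeff (c : ℕ → ℝ) (k : ℕ) : ℝ := (k + 1) * c (k + 1)

/-- For `r < q < 1` the factor `(k + 1) r^k` is eventually at most `q^k`, so the series at `q`
dominates the derived series at `r`. -/
theorem UnitDiscSummable.derivedCoeff {c : ℕ → ℝ} (hc : UnitDiscSummable c) :
    UnitDiscSummable (derivedCoeff c) := by
  intro r h0 h1
  obtain ⟨q, hrq, hq1⟩ := exists_between h1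
  have hq0 : 0 < q := h0.trans_lt hrq
  have hlim : Tendsto (fun k : ℕ => (k : ℝ) ^ 1 * (r / q) ^ k) atTop (𝓝 0) :=
    tendsto_pow_const_mul_const_pow_of_abs_lt_one 1
      (by rw [abs_of_nonneg (by positivity)]; rwa [div_lt_one hq0])
  have hlim1 : Tendsto (fun k : ℕ => (r / q) ^ k) atTop (𝓝 0) :=
    tendsto_pow_atTop_nhds_zero_of_lt_one (by positivity) (by rwa [div_lt_one hq0])
  have hb := (hlim.add hlim1).eventually (gt_mem_nhds (by norm_num : (0 : ℝ) + 0 < 1))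
  have hs := ((summable_nat_add_iff 1).2 (hc q hq0.le hq1)).mul_left (1 / q)
  refine Summable.of_norm_bounded_eventually_nat hs ?_
  filter_upwards [hb] with k hk
  rw [Real.norm_eq_abs, abs_of_nonneg (by positivity), _root_.derivedCoeff, abs_mul,
    abs_of_nonneg (by positivity : (0 : ℝ) ≤ (k : ℝ) + 1)]
  have : ((k : ℝ) + 1) * r ^ k ≤ q ^ k := by
    rw [pow_one, ← add_one_mul, div_pow, mul_div_assoc', div_lt_one (by positivity)] at hk
    exact hk.le
  calc ((k : ℝ) + 1) * |c (k + 1)| * r ^ k = |c (k + 1)| * (((k : ℝ) + 1) * r ^ k) := by ring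
    _ ≤ |c (k + 1)| * q ^ k := by gcongr
    _ = 1 / q * (|c (k + 1)| * q ^ (k + 1)) := by
      rw [pow_succ]
      field_simp

theorem UnitDiscSummable.hasDerivAt {c : ℕ → ℝ} (hc : UnitDiscSummable c) {t : ℝ} (ht : |t| < 1) :
    HasDerivAt (fun t => ∑' k, c k * t ^ k) (∑' k, _root_.derivedCoeff c k * t ^ k) t := by
  obtain ⟨q, htq, hq1⟩ := exists_between ht
  have hq0 : 0 < q := (abs_nonneg t).trans_lt htq
  have hd := hc.derivedCoeff
  have hmem : ∀ y ∈ Ioo (-q) q, |y| < 1 := fun y hy => (abs_lt.2 hy).trans hq1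
  -- Splitting off the constant term makes the `k`-th termwise derivative equal to `derivedCoeff c k
  -- * z ^ k`, with no truncated exponent `k - 1`.
  have key : HasDerivAt (fun z => ∑' k, c (k + 1) * z ^ (k + 1))
      (∑' k, _root_.derivedCoeff c k * t ^ k) t := by
    refine hasDerivAt_tsum_of_isPreconnected (g := fun k z => c (k + 1) * z ^ (k + 1))
      (g' := fun k z => _root_.derivedCoeff c k * z ^ k) (u := fun k => |_root_.derivedCoeff c k| * q ^ k)
      (hd q hq0.le hq1) isOpen_Ioo isPreconnected_Ioo (t := Ioo (-q) q) (y₀ := 0)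
      (fun k y _ => ?_) (fun k y hy => ?_) (by simpa using hq0) ?_ (abs_lt.1 htq)
    · convert! (hasDerivAt_pow (k + 1) y).const_mul (c (k + 1)) using 1
      simp only [_root_.derivedCoeff]
      push_cast
      ring
    · rw [Real.norm_eq_abs, abs_mul, abs_pow]
      have := (abs_lt.2 hy).le
      gcongr
    · simp
  refine (key.const_add (c 0 * t ^ 0)).congr_of_eventuallyEq ?_
  filter_upwards [isOpen_Ioo.mem_nhds (abs_lt.1 htq)] with y hy
  rw [(hc.summable (hmem y hy)).tsum_eq_zero_add]
  simp

/-- The derivative is again a series of the same class, so the induction runs with the coefficients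
generalized. -/
theorem UnitDiscSummable.contDiffOn {c : ℕ → ℝ} (hc : UnitDiscSummable c) (m : ℕ) :
    ContDiffOn ℝ m (fun t => ∑' k, c k * t ^ k) (Ioo (-1) 1) := by
  induction m generalizing c with
  | zero =>
    exact contDiffOn_zero.2 fun t ht => (hc.hasDerivAt (abs_lt.2 ht)).continuousAt.continuousWithinAt
  | succ m ih =>
    push_cast
    rw [contDiffOn_succ_iff_deriv_of_isOpen isOpen_Ioo]
    refine ⟨fun t ht => (hc.hasDerivAt (abs_lt.2 ht)).differentiableAt.differentiableWithinAt,
      by simp, (ih hc.derivedCoeff).congr fun t ht => (hc.hasDerivAt (abs_lt.2 ht)).deriv⟩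

/-! ### The hypergeometric equation -/

theorem unitDiscSummable_gaussCoeff (a b : ℝ) {c : ℝ} (hc : 0 < c) (h : 0 < c - a - b) :
    UnitDiscSummable (gaussCoeff a b c) := .of_summable_abs (summable_abs_gaussCoeff a b hc h)

/-- Once all terms are written as series in `t^k` after index shifts, the coefficient of `t^k` is
exactly the recurrence `gaussCoeff_succ`. -/
theorem gauss_hypergeometric_equation (a b : ℝ) {c : ℝ} (hc : 0 < c) (h : 0 < c - a - b) {t : ℝ}
    (ht : |t| < 1) :
    t * (1 - t) * ∑' k, derivedCoeff (derivedCoeff (gaussCoeff a b c)) k * t ^ k +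
      (c - (a + b + 1) * t) * ∑' k, derivedCoeff (gaussCoeff a b c) k * t ^ k -
      a * b * ∑' k, gaussCoeff a b c k * t ^ k = 0 := by
  have h0 := unitDiscSummable_gaussCoeff a b hc h
  have s0 := (h0.summable ht).hasSum
  have s1 := (h0.derivedCoeff.summable ht).hasSum
  have s2 := (h0.derivedCoeff.derivedCoeff.summable ht).hasSum
  set F0 := ∑' k, gaussCoeff a b c k * t ^ k
  set F1 := ∑' k, derivedCoeff (gaussCoeff a b c) k * t ^ k
  set F2 := ∑' k, derivedCoeff (derivedCoeff (gaussCoeff a b c)) k * t ^ k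
  have t1 : HasSum (fun k : ℕ => (k : ℝ) * gaussCoeff a b c k * t ^ k) (t * F1) := by
    rw [← hasSum_nat_add_iff' 1]
    simp only [Finset.range_one, Finset.sum_singleton, Nat.cast_zero, zero_mul, sub_zero]
    convert! s1.mul_left t using 1
    funext k
    simp only [derivedCoeff]
    push_cast
    ring
  have t2 : HasSum (fun k : ℕ => (k : ℝ) * (k + 1) * gaussCoeff a b c (k + 1) * t ^ k)
      (t * F2) := by
    rw [← hasSum_nat_add_iff' 1]
    simp only [Finset.range_one, Finset.sum_singleton, Nat.cast_zero, zero_mul, sub_zero]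
    convert! s2.mul_left t using 1
    funext k
    simp only [derivedCoeff]
    push_cast
    ring
  have t3 : HasSum (fun k : ℕ => (k : ℝ) * (k - 1) * gaussCoeff a b c k * t ^ k)
      (t * (t * F2)) := by
    rw [← hasSum_nat_add_iff' 1]
    simp only [Finset.range_one, Finset.sum_singleton, Nat.cast_zero, zero_mul, sub_zero]
    convert! t2.mul_left t using 1
    funext k
    push_cast
    ring
  have tot := (((t2.sub t3).add (s1.mul_left c)).sub (t1.mul_left (a + b + 1))).sub
    (s0.mul_left (a * b))
  have hz : HasSum (fun _ : ℕ => (0 : ℝ)) 0 := hasSum_zero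
  have := tot.unique (by
    convert! hz using 1
    funext k
    have := gaussCoeff_succ a b hc k
    simp only [derivedCoeff]
    linear_combination t ^ k * this)
  linear_combination this

/-- Absolute summability at `t = 1` gives a Weierstrass majorant on the closed interval. Continuity
at the endpoint is what yields boundary values on the sphere. -/
theorem continuousOn_tsum_gaussCoeff (a b : ℝ) {c : ℝ} (hc : 0 < c) (h : 0 < c - a - b) :
    ContinuousOn (fun t => ∑' k, gaussCoeff a b c k * t ^ k) (Icc 0 1) := by
  refine continuousOn_tsum (fun k => by fun_prop) (summable_abs_gaussCoeff a b hc h)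
    fun k t ht => ?_
  rw [Real.norm_eq_abs, abs_mul, abs_pow, abs_of_nonneg ht.1]
  exact mul_le_of_le_one_right (abs_nonneg _) (pow_le_one₀ ht.1 ht.2)

/-! ### Large parameters -/

theorem ringChoose_eq_ascPochhammer_div (b : ℝ) (k : ℕ) :
    Ring.choose (b + k - 1) k = ((k.factorial : ℕ) : ℝ)⁻¹ * (ascPochhammer ℝ k).eval b := by
  have h := Ring.factorial_nsmul_multichoose_eq_ascPochhammer b k
  rw [Polynomial.ascPochhammer_smeval_eq_eval] at h
  have h2 : Ring.choose (b + k - 1) k = Ring.multichoose b k := by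
    rw [Ring.choose]
    congr 1
    ring
  rw [h2, ← h, nsmul_eq_mul]
  have h6 : ((k.factorial : ℕ) : ℝ) ≠ 0 := by positivity
  field_simp

theorem hasSum_ascPochhammer_div_factorial (b : ℝ) {t : ℝ} (ht : |t| < 1) :
    HasSum (fun k : ℕ => ((k.factorial : ℕ) : ℝ)⁻¹ * (ascPochhammer ℝ k).eval b * t ^ k)
      (1 / (1 - t) ^ b) := by
  have h := (Real.one_div_one_sub_rpow_hasFPowerSeriesOnBall_zero b).hasSum (y := t)
    (by
      rw [Metric.mem_eball, edist_zero_right, ← ofReal_norm, ENNReal.ofReal_lt_one]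
      exact ht)
  simp only [FormalMultilinearSeries.ofScalars_apply_eq, ringChoose_eq_ascPochhammer_div,
    smul_eq_mul, zero_add] at h
  exact h

theorem summable_abs_ascPochhammer_div_factorial (b : ℝ) {t : ℝ} (h0 : 0 ≤ t) (ht : t < 1) :
    Summable (fun k : ℕ => |((k.factorial : ℕ) : ℝ)⁻¹ * (ascPochhammer ℝ k).eval b| * t ^ k) := by
  have := (hasSum_ascPochhammer_div_factorial b
    (by rwa [abs_of_nonneg h0] : |t| < 1)).summable.abs
  simpa [abs_mul, abs_of_nonneg h0] using this

/-- The ratio `(a)_k / (c)_k` lies in `(0, 1]`. The resulting binomial majorant is independent of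
`a` and `c`, hence uniform in the degree `l` later on. -/
theorem gaussCoeff_abs_le {a c : ℝ} (b : ℝ) (ha : 0 < a) (hac : a ≤ c) (k : ℕ) :
    |gaussCoeff a b c k| ≤ |((k.factorial : ℕ) : ℝ)⁻¹ * (ascPochhammer ℝ k).eval b| := by
  have h1 := ascPochhammer_eval_pos_of_pos ha k
  have h2 := ascPochhammer_eval_mono ha hac k
  have h3 := h1.trans_le h2
  have : gaussCoeff a b c k = (((k.factorial : ℕ) : ℝ)⁻¹ * (ascPochhammer ℝ k).eval b) *
      ((ascPochhammer ℝ k).eval a / (ascPochhammer ℝ k).eval c) := by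
    rw [gaussCoeff, ordinaryHypergeometricCoefficient]
    ring
  rw [this, abs_mul, abs_of_pos (div_pos h1 h3)]
  exact mul_le_of_le_one_right (abs_nonneg _) ((div_le_one h3).2 h2)

/-- For fixed `k` the ratio `(l + α)_k / (l + β)_k` tends to `1`, and the binomial majorant applies
as soon as `l + α > 0`; the limit is the binomial series. Its being nonzero is what prevents the
radial factors from degenerating at high degree. -/
theorem tendsto_tsum_gaussCoeff_natCast_add (b : ℝ) {α β : ℝ} (hαβ : α ≤ β) {t : ℝ}
    (h0 : 0 ≤ t) (ht : t < 1) :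
    Tendsto (fun l : ℕ => ∑' k, gaussCoeff (l + α) b (l + β) k * t ^ k) atTop
      (𝓝 (1 / (1 - t) ^ b)) := by
  rw [← (hasSum_ascPochhammer_div_factorial b (by rwa [abs_of_nonneg h0] : |t| < 1)).tsum_eq]
  refine tendsto_tsum_of_dominated_convergence (summable_abs_ascPochhammer_div_factorial b h0 ht)
    (fun k => ?_) ?_
  · refine Tendsto.mul_const _ ?_
    have hratio : Tendsto (fun l : ℕ => (ascPochhammer ℝ k).eval (l + α) /
        (ascPochhammer ℝ k).eval (l + β)) atTop (𝓝 1) := by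
      induction k with
      | zero => simp
      | succ k ih =>
        simp_rw [ascPochhammer_succ_eval, mul_div_mul_comm]
        rw [← one_mul (1 : ℝ)]
        refine ih.mul ?_
        convert! tendsto_add_mul_div_add_mul_atTop_nhds (α + k) (β + k) (1 : ℝ) (d := 1)
          one_ne_zero using 2
        · ring_nf
        · simp
    convert hratio.const_mul (((k.factorial : ℕ) : ℝ)⁻¹ * (ascPochhammer ℝ k).eval b) using 2
    · rw [gaussCoeff, ordinaryHypergeometricCoefficient]
      ring
    · ring
  · filter_upwards [(tendsto_natCast_atTop_atTop (R := ℝ)).eventually_gt_atTop (-α)] with l hl k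
    rw [Real.norm_eq_abs, abs_mul, abs_pow, abs_of_nonneg h0]
    have := gaussCoeff_abs_le (a := l + α) (c := l + β) b (by linarith) (by linarith) k
    gcongr

theorem abs_tsum_gaussCoeff_le {a c : ℝ} (b : ℝ) (ha : 0 < a) (hac : a ≤ c) {t : ℝ}
    (h0 : 0 ≤ t) (ht : t < 1) : |∑' k, gaussCoeff a b c k * t ^ k| ≤
      ∑' k : ℕ, |((k.factorial : ℕ) : ℝ)⁻¹ * (ascPochhammer ℝ k).eval b| * t ^ k := by
  rw [← Real.norm_eq_abs]
  refine tsum_of_norm_bounded (summable_abs_ascPochhammer_div_factorial b h0 ht).hasSum fun k => ?_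
  rw [Real.norm_eq_abs, abs_mul, abs_pow, abs_of_nonneg h0]
  have := gaussCoeff_abs_le b ha hac k
  gcongr

/-! ### The radial profiles -/

theorem radialHypergeometric_eq_tsum (n : ℕ) (γ : ℝ) (l : ℕ) (t : ℝ) :
    radialHypergeometric n γ l t =
      ∑' k, gaussCoeff (l + n / 2 - γ) (1 / 2 - γ) (l + (n + 1) / 2) k * t ^ k :=
  ordinaryHypergeometric_eq_tsum_gaussCoeff _ _ _ _

/-- The parameter excess `c - a - b` equals `2γ`, so positivity of `γ` is what makes the series
converge at `t = 1`. -/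
theorem radial_param_sub {γ : ℝ} (hγ : 0 < γ) (n l : ℕ) :
    0 < ((l : ℝ) + (n + 1) / 2) - (l + n / 2 - γ) - (1 / 2 - γ) := by
  have : ((l : ℝ) + (n + 1) / 2) - (l + n / 2 - γ) - (1 / 2 - γ) = 2 * γ := by ring
  rw [this]
  positivity

theorem radialHypergeometric_one {γ : ℝ} (hγ : 0 < γ) (n l : ℕ) :
    radialHypergeometric n γ l 1 = Real.Gamma (l + (n + 1) / 2) * Real.Gamma (2 * γ) /
      (Real.Gamma (γ + 1 / 2) * Real.Gamma (l + γ + n / 2)) := by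
  rw [radialHypergeometric_eq_tsum]
  simp only [one_pow, mul_one]
  have e1 : ((l : ℝ) + (n + 1) / 2) - (l + n / 2 - γ) = γ + 1 / 2 := by ring
  have e2 : ((l : ℝ) + (n + 1) / 2) - (1 / 2 - γ) = l + γ + n / 2 := by ring
  have e3 : ((l : ℝ) + (n + 1) / 2) - (l + n / 2 - γ) - (1 / 2 - γ) = 2 * γ := by ring
  rw [tsum_gaussCoeff_eq_gamma (by positivity) (radial_param_sub hγ n l)
    (by rw [e1]; positivity) (by rw [e2]; positivity), e3, e1, e2]

theorem radialHypergeometric_one_pos {γ : ℝ} (hγ : 0 < γ) (n l : ℕ) :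
    0 < radialHypergeometric n γ l 1 := by
  rw [radialHypergeometric_one hγ]
  have h1 := Real.Gamma_pos_of_pos (by positivity : 0 < (l : ℝ) + (n + 1) / 2)
  have h2 := Real.Gamma_pos_of_pos (by positivity : 0 < 2 * γ)
  have h3 := Real.Gamma_pos_of_pos (by positivity : 0 < γ + 1 / 2)
  have h4 := Real.Gamma_pos_of_pos (by positivity : 0 < (l : ℝ) + γ + n / 2)
  positivity

theorem radialProfile_eq_gamma_mul {γ : ℝ} (hγ : 0 < γ) (n l : ℕ) (t : ℝ) :
    radialProfile n γ l t = Real.Gamma (γ + 1 / 2) / Real.Gamma (2 * γ) *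
      (Real.Gamma (l + γ + n / 2) / Real.Gamma (l + (n + 1) / 2)) *
      radialHypergeometric n γ l t := by
  have h1 := Real.Gamma_pos_of_pos (by positivity : 0 < (l : ℝ) + (n + 1) / 2)
  have h2 := Real.Gamma_pos_of_pos (by positivity : 0 < 2 * γ)
  have h3 := Real.Gamma_pos_of_pos (by positivity : 0 < γ + 1 / 2)
  have h4 := Real.Gamma_pos_of_pos (by positivity : 0 < (l : ℝ) + γ + n / 2)
  rw [radialProfile, radialHypergeometric_one hγ]
  field_simp

theorem radialHypergeometric_zero (n : ℕ) (γ : ℝ) (l : ℕ) : radialHypergeometric n γ l 0 = 1 :=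
  ordinaryHypergeometric_zero _ _ _

theorem continuousOn_radialHypergeometric {γ : ℝ} (hγ : 0 < γ) (n l : ℕ) :
    ContinuousOn (radialHypergeometric n γ l) (Icc 0 1) := by
  rw [funext (radialHypergeometric_eq_tsum n γ l)]
  exact continuousOn_tsum_gaussCoeff _ _ (by positivity) (radial_param_sub hγ n l)

theorem contDiffOn_radialHypergeometric {γ : ℝ} (hγ : 0 < γ) (n l : ℕ) :
    ContDiffOn ℝ 2 (radialHypergeometric n γ l) (Ioo (-1) 1) := by
  rw [funext (radialHypergeometric_eq_tsum n γ l)]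
  exact_mod_cast (unitDiscSummable_gaussCoeff _ _ (by positivity)
    (radial_param_sub hγ n l)).contDiffOn 2

/-- The hypergeometric equation for the radial profiles. -/
theorem exists_deriv_radialHypergeometric {γ : ℝ} (hγ : 0 < γ) (n l : ℕ) :
    ∃ F1 F2 : ℝ → ℝ, ∀ t : ℝ, |t| < 1 →
      HasDerivAt (radialHypergeometric n γ l) (F1 t) t ∧ HasDerivAt F1 (F2 t) t ∧
      t * (1 - t) * F2 t + (l + (n + 1) / 2 - (l + n / 2 - γ + (1 / 2 - γ) + 1) * t) * F1 t -
        (l + n / 2 - γ) * (1 / 2 - γ) * radialHypergeometric n γ l t = 0 := by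
  rw [funext (radialHypergeometric_eq_tsum n γ l)]
  have h := unitDiscSummable_gaussCoeff (l + n / 2 - γ) (1 / 2 - γ)
    (by positivity : 0 < (l : ℝ) + (n + 1) / 2) (radial_param_sub hγ n l)
  exact ⟨_, _, fun t ht => ⟨h.hasDerivAt ht, h.derivedCoeff.hasDerivAt ht,
    gauss_hypergeometric_equation _ _ (by positivity) (radial_param_sub hγ n l) ht⟩⟩

/-- For `q < 1` the ratios `F_l(t) / F_l(q)` are bounded in `l`. -/
theorem exists_radialHypergeometric_ratio_bound {γ : ℝ} (hγ : 0 < γ) (n : ℕ) {t q : ℝ}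
    (h0 : 0 ≤ t) (ht : t < 1) (hq0 : 0 ≤ q) (hq : q < 1) :
    ∃ C : ℝ, ∀ᶠ l : ℕ in atTop, |radialHypergeometric n γ l t| ≤ C * |radialHypergeometric n γ l q|
    := by
  set B := ∑' k : ℕ, |((k.factorial : ℕ) : ℝ)⁻¹ * (ascPochhammer ℝ k).eval (1 / 2 - γ)| * t ^ k
  have hB : 0 ≤ B := tsum_nonneg fun k => by positivity
  have hL : 0 < 1 / (1 - q) ^ (1 / 2 - γ) := by
    have : 0 < 1 - q := by linarith
    positivity
  set L := 1 / (1 - q) ^ (1 / 2 - γ)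
  have hlim := tendsto_tsum_gaussCoeff_natCast_add (1 / 2 - γ) (α := n / 2 - γ)
    (β := ((n : ℝ) + 1) / 2) (by linarith) hq0 hq
  -- `B` bounds the numerators for all large `l` through the binomial majorant; the denominators
  -- tend to `L > 0` and so eventually exceed `L / 2`.
  refine ⟨B / (L / 2), ?_⟩
  filter_upwards [hlim.eventually (lt_mem_nhds (half_lt_self hL)),
    (tendsto_natCast_atTop_atTop (R := ℝ)).eventually_gt_atTop (γ - n / 2)] with l hl1 hl2
  have e : radialHypergeometric n γ l q = ∑' k : ℕ, gaussCoeff (l + (n / 2 - γ)) (1 / 2 - γ)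
      (l + (n + 1) / 2) k * q ^ k := by
    rw [radialHypergeometric_eq_tsum, add_sub_assoc]
  rw [← e] at hl1
  have h2 : |radialHypergeometric n γ l t| ≤ B := by
    rw [radialHypergeometric_eq_tsum]
    exact abs_tsum_gaussCoeff_le _ (by linarith) (by linarith) h0 ht
  refine h2.trans ?_
  rw [div_mul_eq_mul_div, le_div_iff₀ (by positivity)]
  exact mul_le_mul_of_nonneg_left (hl1.le.trans (le_abs_self _)) hB
end

noncomputable section

/-! ### Partial derivatives -/

variable {n : ℕ}

theorem Filter.EventuallyEq.partialDeriv_eq {u v : RSpace n → ℝ} {x : RSpace n} (i : Fin (n + 1))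
    (h : u =ᶠ[𝓝 x] v) : partialDeriv i u x = partialDeriv i v x := by
  rw [partialDeriv, partialDeriv, h.fderiv_eq]

theorem Filter.EventuallyEq.partialDeriv {u v : RSpace n → ℝ} {x : RSpace n} (i : Fin (n + 1))
    (h : u =ᶠ[𝓝 x] v) : partialDeriv i u =ᶠ[𝓝 x] partialDeriv i v := by
  filter_upwards [h.eventuallyEq_nhds] with y hy using hy.partialDeriv_eq i

theorem partialDeriv_sub {u v : RSpace n → ℝ} {x : RSpace n} (i : Fin (n + 1))
    (hu : DifferentiableAt ℝ u x) (hv : DifferentiableAt ℝ v x) :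
    partialDeriv i (fun y => u y - v y) x = partialDeriv i u x - partialDeriv i v x := by
  simp [partialDeriv, fderiv_fun_sub hu hv]

theorem partialDeriv_add {u v : RSpace n → ℝ} {x : RSpace n} (i : Fin (n + 1))
    (hu : DifferentiableAt ℝ u x) (hv : DifferentiableAt ℝ v x) :
    partialDeriv i (fun y => u y + v y) x = partialDeriv i u x + partialDeriv i v x := by
  simp [partialDeriv, fderiv_fun_add hu hv]

theorem partialDeriv_const_mul {u : RSpace n → ℝ} {x : RSpace n} (i : Fin (n + 1)) (c : ℝ)
    (hu : DifferentiableAt ℝ u x) :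
    partialDeriv i (fun y => c * u y) x = c * partialDeriv i u x := by
  simp [partialDeriv, fderiv_const_mul hu c]

theorem partialDeriv_mul {u v : RSpace n → ℝ} {x : RSpace n} (i : Fin (n + 1))
    (hu : DifferentiableAt ℝ u x) (hv : DifferentiableAt ℝ v x) :
    partialDeriv i (fun y => u y * v y) x = u x * partialDeriv i v x + v x * partialDeriv i u x := by
  simp [partialDeriv, fderiv_fun_mul hu hv]

theorem ContDiffAt.partialDeriv {u : RSpace n → ℝ} {x : RSpace n} (i : Fin (n + 1))
    (hu : ContDiffAt ℝ 2 u x) : ContDiffAt ℝ 1 (partialDeriv i u) x :=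
  (hu.fderiv_right (m := 1) (by norm_num)).clm_apply contDiffAt_const

theorem ContDiffAt.differentiableAt_partialDeriv {u : RSpace n → ℝ} {x : RSpace n}
    (i : Fin (n + 1)) (hu : ContDiffAt ℝ 2 u x) : DifferentiableAt ℝ (_root_.partialDeriv i u) x :=
  (hu.partialDeriv i).differentiableAt (by norm_num)

theorem ContDiffAt.eventually_differentiableAt {u : RSpace n → ℝ} {x : RSpace n}
    (hu : ContDiffAt ℝ 2 u x) : ∀ᶠ y in 𝓝 x, DifferentiableAt ℝ u y :=
  (hu.eventually (by simp)).mono fun _ hy => hy.differentiableAt (by norm_num)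

/-- The flat Laplacian `∑_i ∂_i² u`. -/
def flatLaplacian (u : RSpace n → ℝ) (x : RSpace n) : ℝ := ∑ i, partialDeriv i (partialDeriv i u) x

/-- The Euler operator `∑_i x_i ∂_i u`. -/
def eulerOperator (u : RSpace n → ℝ) (x : RSpace n) : ℝ := ∑ i, x i * partialDeriv i u x

theorem flatLaplacian_sub {u v : RSpace n → ℝ} {x : RSpace n} (hu : ContDiffAt ℝ 2 u x)
    (hv : ContDiffAt ℝ 2 v x) :
    flatLaplacian (fun y => u y - v y) x = flatLaplacian u x - flatLaplacian v x := by
  simp only [flatLaplacian, ← Finset.sum_sub_distrib]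
  refine Finset.sum_congr rfl fun i _ => ?_
  rw [← partialDeriv_sub i (hu.differentiableAt_partialDeriv i) (hv.differentiableAt_partialDeriv i)]
  refine Filter.EventuallyEq.partialDeriv_eq i ?_
  filter_upwards [hu.eventually_differentiableAt, hv.eventually_differentiableAt] with y h1 h2
    using partialDeriv_sub i h1 h2

theorem flatLaplacian_add {u v : RSpace n → ℝ} {x : RSpace n} (hu : ContDiffAt ℝ 2 u x)
    (hv : ContDiffAt ℝ 2 v x) :
    flatLaplacian (fun y => u y + v y) x = flatLaplacian u x + flatLaplacian v x := by
  simp only [flatLaplacian, ← Finset.sum_add_distrib]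
  refine Finset.sum_congr rfl fun i _ => ?_
  rw [← partialDeriv_add i (hu.differentiableAt_partialDeriv i) (hv.differentiableAt_partialDeriv i)]
  refine Filter.EventuallyEq.partialDeriv_eq i ?_
  filter_upwards [hu.eventually_differentiableAt, hv.eventually_differentiableAt] with y h1 h2
    using partialDeriv_add i h1 h2

theorem flatLaplacian_const_mul {u : RSpace n → ℝ} {x : RSpace n} (c : ℝ)
    (hu : ContDiffAt ℝ 2 u x) :
    flatLaplacian (fun y => c * u y) x = c * flatLaplacian u x := by
  simp only [flatLaplacian, Finset.mul_sum]
  refine Finset.sum_congr rfl fun i _ => ?_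
  rw [← partialDeriv_const_mul i c (hu.differentiableAt_partialDeriv i)]
  refine Filter.EventuallyEq.partialDeriv_eq i ?_
  filter_upwards [hu.eventually_differentiableAt] with y h1 using partialDeriv_const_mul i c h1

theorem flatLaplacian_mul {u v : RSpace n → ℝ} {x : RSpace n} (hu : ContDiffAt ℝ 2 u x)
    (hv : ContDiffAt ℝ 2 v x) :
    flatLaplacian (fun y => u y * v y) x = u x * flatLaplacian v x + v x * flatLaplacian u x +
      2 * ∑ i, partialDeriv i u x * partialDeriv i v x := by
  simp only [flatLaplacian, Finset.mul_sum, ← Finset.sum_add_distrib]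
  refine Finset.sum_congr rfl fun i _ => ?_
  have hu1 := hu.differentiableAt (by norm_num : (2 : WithTop ℕ∞) ≠ 0)
  have hv1 := hv.differentiableAt (by norm_num : (2 : WithTop ℕ∞) ≠ 0)
  have hu2 := hu.differentiableAt_partialDeriv i
  have hv2 := hv.differentiableAt_partialDeriv i
  have e : partialDeriv i (fun y => u y * v y) =ᶠ[𝓝 x]
      fun y => u y * partialDeriv i v y + v y * partialDeriv i u y := by
    filter_upwards [hu.eventually_differentiableAt, hv.eventually_differentiableAt] with y h1 h2
      using partialDeriv_mul i h1 h2
  rw [e.partialDeriv_eq i, partialDeriv_add (u := fun y => u y * partialDeriv i v y)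
    (v := fun y => v y * partialDeriv i u y) i (hu1.mul hv2) (hv1.mul hu2),
    partialDeriv_mul i hu1 hv2, partialDeriv_mul i hv1 hu2]
  ring

theorem eulerOperator_sub {u v : RSpace n → ℝ} {x : RSpace n} (hu : DifferentiableAt ℝ u x)
    (hv : DifferentiableAt ℝ v x) :
    eulerOperator (fun y => u y - v y) x = eulerOperator u x - eulerOperator v x := by
  simp only [eulerOperator, partialDeriv_sub _ hu hv, mul_sub, Finset.sum_sub_distrib]

theorem eulerOperator_add {u v : RSpace n → ℝ} {x : RSpace n} (hu : DifferentiableAt ℝ u x)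
    (hv : DifferentiableAt ℝ v x) :
    eulerOperator (fun y => u y + v y) x = eulerOperator u x + eulerOperator v x := by
  simp only [eulerOperator, partialDeriv_add _ hu hv, mul_add, Finset.sum_add_distrib]

theorem eulerOperator_const_mul {u : RSpace n → ℝ} {x : RSpace n} (c : ℝ)
    (hu : DifferentiableAt ℝ u x) :
    eulerOperator (fun y => c * u y) x = c * eulerOperator u x := by
  simp only [eulerOperator, partialDeriv_const_mul _ c hu, Finset.mul_sum]
  exact Finset.sum_congr rfl fun i _ => by ring

theorem eulerOperator_mul {u v : RSpace n → ℝ} {x : RSpace n} (hu : DifferentiableAt ℝ u x)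
    (hv : DifferentiableAt ℝ v x) :
    eulerOperator (fun y => u y * v y) x = u x * eulerOperator v x + v x * eulerOperator u x := by
  simp only [eulerOperator, partialDeriv_mul _ hu hv, Finset.mul_sum, ← Finset.sum_add_distrib]
  exact Finset.sum_congr rfl fun i _ => by ring

/-! ### Radial functions -/

theorem sum_sq_coord (x : RSpace n) : ∑ i, x i ^ 2 = ‖x‖ ^ 2 :=
  (EuclideanSpace.real_norm_sq_eq x).symm

theorem hasFDerivAt_norm_sub_sq (c x : RSpace n) :
    HasFDerivAt (fun y => ‖y - c‖ ^ 2) (2 • innerSL ℝ (x - c)) x := by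
  simpa using ((hasFDerivAt_id x).sub_const c).norm_sq

theorem partialDeriv_of_hasFDerivAt {u : RSpace n → ℝ} {L : RSpace n →L[ℝ] ℝ} {x : RSpace n}
    (i : Fin (n + 1)) (h : HasFDerivAt u L x) :
    partialDeriv i u x = L (EuclideanSpace.single i 1) := by
  rw [partialDeriv, h.fderiv]

theorem partialDeriv_radial (i : Fin (n + 1)) (c : RSpace n) {H : ℝ → ℝ} {H' : ℝ} {x : RSpace n}
    (hH : HasDerivAt H H' (‖x - c‖ ^ 2)) :
    partialDeriv i (fun y => H (‖y - c‖ ^ 2)) x = 2 * (x i - c i) * H' := by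
  have : HasFDerivAt (fun y => H (‖y - c‖ ^ 2)) _ x :=
    hH.comp_hasFDerivAt x (hasFDerivAt_norm_sub_sq c x)
  rw [partialDeriv_of_hasFDerivAt i this]
  simp [EuclideanSpace.inner_single_right]
  ring

theorem partialDeriv_coord_sub (i : Fin (n + 1)) (c x : RSpace n) :
    partialDeriv i (fun y => 2 * (y i - c i)) x = 2 := by
  have h1 : HasFDerivAt (fun y : RSpace n => y i)
    (EuclideanSpace.proj i : RSpace n →L[ℝ] ℝ) x := (EuclideanSpace.proj i : RSpace n →L[ℝ] ℝ).hasFDerivAt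
  have := (h1.sub_const (c i)).const_mul 2
  rw [partialDeriv_of_hasFDerivAt i this]
  simp

theorem tendsto_norm_sub_sq (c x : RSpace n) :
    Tendsto (fun y => ‖y - c‖ ^ 2) (𝓝 x) (𝓝 (‖x - c‖ ^ 2)) :=
  (hasFDerivAt_norm_sub_sq c x).continuousAt

/-- Radial functions are written in terms of the squared distance, which is smooth at the centre, so
no point has to be excluded. -/
theorem flatLaplacian_radial (c : RSpace n) {H H1 : ℝ → ℝ} {H2 : ℝ} {x : RSpace n}
    (hH : ∀ᶠ q in 𝓝 (‖x - c‖ ^ 2), HasDerivAt H (H1 q) q)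
    (hH1 : HasDerivAt H1 H2 (‖x - c‖ ^ 2)) :
    flatLaplacian (fun y => H (‖y - c‖ ^ 2)) x =
      2 * (n + 1) * H1 (‖x - c‖ ^ 2) + 4 * ‖x - c‖ ^ 2 * H2 := by
  have key : ∀ i : Fin (n + 1), partialDeriv i (partialDeriv i (fun y => H (‖y - c‖ ^ 2))) x =
      2 * H1 (‖x - c‖ ^ 2) + 4 * (x - c) i ^ 2 * H2 := by
    intro i
    have e : partialDeriv i (fun y => H (‖y - c‖ ^ 2)) =ᶠ[𝓝 x]
        fun y => (2 * (y i - c i)) * H1 (‖y - c‖ ^ 2) := by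
      filter_upwards [(tendsto_norm_sub_sq c x).eventually hH] with y hy
        using partialDeriv_radial i c hy
    have hd1 : DifferentiableAt ℝ (fun y : RSpace n => 2 * (y i - c i)) x := by fun_prop
    have hd2 : DifferentiableAt ℝ (fun y : RSpace n => H1 (‖y - c‖ ^ 2)) x :=
      (hH1.comp_hasFDerivAt x (hasFDerivAt_norm_sub_sq c x)).differentiableAt
    rw [e.partialDeriv_eq i, partialDeriv_mul i hd1 hd2, partialDeriv_radial i c hH1,
      partialDeriv_coord_sub]
    simp only [PiLp.sub_apply]
    ring
  rw [flatLaplacian, Finset.sum_congr rfl fun i _ => key i, Finset.sum_add_distrib,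
    ← Finset.sum_mul _ _ H2, ← Finset.mul_sum _ _ 4, sum_sq_coord]
  simp
  ring

theorem eulerOperator_radial (c : RSpace n) {H : ℝ → ℝ} {H' : ℝ} {x : RSpace n}
    (hH : HasDerivAt H H' (‖x - c‖ ^ 2)) :
    eulerOperator (fun y => H (‖y - c‖ ^ 2)) x = 2 * inner ℝ x (x - c) * H' := by
  simp only [eulerOperator, partialDeriv_radial _ c hH, PiLp.inner_apply, Finset.mul_sum,
    Finset.sum_mul]
  refine Finset.sum_congr rfl fun i _ => ?_
  simp
  ring

theorem contDiffAt_radial (c : RSpace n) {H : ℝ → ℝ} {x : RSpace n}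
    (hH : ContDiffAt ℝ 2 H (‖x - c‖ ^ 2)) : ContDiffAt ℝ 2 (fun y => H (‖y - c‖ ^ 2)) x := by
  have h2 : ContDiffAt ℝ 2 (fun y : RSpace n => ‖y - c‖ ^ 2) x :=
    (contDiffAt_id.sub contDiffAt_const).norm_sq ℝ
  exact ContDiffAt.comp x (g := H) (f := fun y : RSpace n => ‖y - c‖ ^ 2) hH h2

/-! ### Polynomials -/

/-- The function on `ℝ^{n+1}` defined by a polynomial. -/
def polyFun (p : MvPolynomial (Fin (n + 1)) ℝ) (x : RSpace n) : ℝ := MvPolynomial.eval (fun i => x i) p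

theorem contDiff_polyFun (p : MvPolynomial (Fin (n + 1)) ℝ) : ContDiff ℝ 2 (polyFun p) := by
  induction p using MvPolynomial.induction_on with
  | C a =>
    rw [show polyFun (n := n) (MvPolynomial.C a) = fun _ => a by funext y; simp [polyFun]]
    exact contDiff_const
  | add p q hp hq =>
    rw [show polyFun (n := n) (p + q) = fun y => polyFun p y + polyFun q y by
      funext y; simp [polyFun]]
    exact hp.add hq
  | mul_X p i hp =>
    rw [show polyFun (n := n) (p * MvPolynomial.X i) = fun y => polyFun p y * y i by
      funext y; simp [polyFun]]
    have : ContDiff ℝ 2 (fun y : RSpace n => y i) := by fun_prop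
    exact hp.mul this

theorem differentiableAt_polyFun (p : MvPolynomial (Fin (n + 1)) ℝ) (x : RSpace n) :
    DifferentiableAt ℝ (polyFun p) x := (contDiff_polyFun p).differentiable (by norm_num) x

theorem partialDeriv_polyFun (i : Fin (n + 1)) (p : MvPolynomial (Fin (n + 1)) ℝ) :
    partialDeriv i (polyFun p) = polyFun (MvPolynomial.pderiv i p) := by
  funext x
  induction p using MvPolynomial.induction_on with
  | C a =>
    have : polyFun (n := n) (MvPolynomial.C a) = fun _ => a := by funext y; simp [polyFun]
    rw [this]
    simp [partialDeriv, polyFun]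
  | add p q hp hq =>
    have : polyFun (n := n) (p + q) = fun y => polyFun p y + polyFun q y := by
      funext y; simp [polyFun]
    rw [this, partialDeriv_add i (differentiableAt_polyFun p x) (differentiableAt_polyFun q x), hp,
      hq]
    simp [polyFun]
  | mul_X p j hp =>
    have : polyFun (n := n) (p * MvPolynomial.X j) = fun y => polyFun p y * y j := by
      funext y; simp [polyFun]
    have h1 : HasFDerivAt (fun y : RSpace n => y j) (EuclideanSpace.proj j : RSpace n →L[ℝ] ℝ) x :=
      (EuclideanSpace.proj j : RSpace n →L[ℝ] ℝ).hasFDerivAt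
    rw [this, partialDeriv_mul i (differentiableAt_polyFun p x) h1.differentiableAt, hp,
      partialDeriv_of_hasFDerivAt i h1]
    rcases eq_or_ne i j with rfl | hij
    · simp [polyFun, Derivation.leibniz]
    · simp [polyFun, Derivation.leibniz, MvPolynomial.pderiv_X, hij.symm]

theorem flatLaplacian_polyFun {p : MvPolynomial (Fin (n + 1)) ℝ}
    (hp : ∑ i, MvPolynomial.pderiv i (MvPolynomial.pderiv i p) = 0) (x : RSpace n) :
    flatLaplacian (polyFun p) x = 0 := by
  have := congrArg (fun q => polyFun q x) hp
  simpa [polyFun, flatLaplacian, partialDeriv_polyFun] using this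

theorem eulerOperator_polyFun {l : ℕ} {p : MvPolynomial (Fin (n + 1)) ℝ} (hp : p.IsHomogeneous l)
    (x : RSpace n) : eulerOperator (polyFun p) x = l * polyFun p x := by
  have := congrArg (fun q => polyFun q x) hp.sum_X_mul_pderiv
  simpa [polyFun, eulerOperator, partialDeriv_polyFun] using this

theorem polyFun_smul {l : ℕ} {p : MvPolynomial (Fin (n + 1)) ℝ} (hp : p.IsHomogeneous l) (r : ℝ)
    (x : RSpace n) : polyFun p (r • x) = r ^ l * polyFun p x := by
  simp only [polyFun, MvPolynomial.eval_eq, Finset.mul_sum]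
  refine Finset.sum_congr rfl fun d hd => ?_
  have hdl : ∑ i ∈ d.support, d i = l := by
    have := hp (MvPolynomial.mem_support_iff.1 hd)
    rwa [Pi.one_def, ← Finsupp.degree_eq_weight_one, Finsupp.degree_apply] at this
  simp only [PiLp.smul_apply, smul_eq_mul, mul_pow, Finset.prod_mul_distrib,
    Finset.prod_pow_eq_pow_sum, hdl]
  ring

/-! ### The Laplace-Beltrami operator of the Poincaré metric -/

theorem mem_unitBall {x : RSpace n} : x ∈ unitBall n ↔ ‖x‖ < 1 := by simp [unitBall]

theorem isOpen_unitBall : IsOpen (unitBall n) := Metric.isOpen_ball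

theorem flatDefining_pos {x : RSpace n} (hx : x ∈ unitBall n) : 0 < flatDefining x := by
  rw [mem_unitBall] at hx
  have : ‖x‖ ^ 2 < 1 := by nlinarith [norm_nonneg x]
  simp only [flatDefining]
  linarith

theorem hasFDerivAt_flatDefining (x : RSpace n) :
    HasFDerivAt flatDefining (-(innerSL ℝ x)) x := by
  have h := ((hasFDerivAt_norm_sub_sq 0 x).const_sub 1).mul_const (1 / 2 : ℝ)
  simp only [sub_zero] at h
  have e1 : flatDefining (n := n) = fun y => (1 - ‖y‖ ^ 2) * (1 / 2) := by
    funext y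
    simp only [flatDefining]
    ring
  have e2 : -(innerSL ℝ) x = (1 / 2 : ℝ) • -(2 • (innerSL ℝ) x) := by
    ext y
    simp
  rw [e1, e2]
  exact h

theorem poincareMetric_eq (x : RSpace n) :
    poincareMetric n x = (flatDefining x ^ 2)⁻¹ • (1 : Matrix (Fin (n + 1)) (Fin (n + 1)) ℝ) := by
  rw [poincareMetric, flatDefining, div_pow, inv_div]
  norm_num

/-- The metric is `ρ₀^{-2}` times the identity, so the operator is `ρ₀^{n+1} ∑ ∂_i (ρ₀^{1-n} ∂_i
u)`, and `∂_i ρ₀ = -x_i`. The exponent `1 - n` may be negative, whence integer powers. -/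
theorem laplaceBeltrami_poincareMetric {u : RSpace n → ℝ} {x : RSpace n} (hx : x ∈ unitBall n)
    (hu : ContDiffAt ℝ 2 u x) :
    laplaceBeltrami (poincareMetric n) u x = flatDefining x ^ 2 * flatLaplacian u x +
      (n - 1) * flatDefining x * eulerOperator u x := by
  have hdet : ∀ y ∈ unitBall n, Real.sqrt (poincareMetric n y).det =
      (flatDefining y ^ (n + 1))⁻¹ := by
    intro y hy
    have := flatDefining_pos hy
    rw [poincareMetric_eq, Matrix.det_smul, Matrix.det_one, mul_one, Fintype.card_fin, inv_pow,
      ← pow_mul, mul_comm 2, pow_mul, Real.sqrt_inv, Real.sqrt_sq (by positivity)]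
  have hinv : ∀ y ∈ unitBall n, (poincareMetric n y)⁻¹ =
      (flatDefining y ^ 2) • (1 : Matrix (Fin (n + 1)) (Fin (n + 1)) ℝ) := by
    intro y hy
    have := flatDefining_pos hy
    refine Matrix.inv_eq_left_inv ?_
    rw [poincareMetric_eq, Matrix.smul_mul, Matrix.mul_smul, one_mul, smul_smul,
      mul_inv_cancel₀ (by positivity), one_smul]
  have hρ := flatDefining_pos hx
  have hW : ∀ i : Fin (n + 1), HasFDerivAt (fun y : RSpace n => flatDefining y ^ (1 - n : ℤ))
      ((((1 - n : ℤ) : ℝ) * flatDefining x ^ (1 - n - 1 : ℤ)) • -(innerSL ℝ x)) x := fun i =>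
    (hasDerivAt_zpow (1 - n : ℤ) (flatDefining x) (Or.inl hρ.ne')).comp_hasFDerivAt x
      (hasFDerivAt_flatDefining x)
  have key : ∀ i, partialDeriv i (fun y => Real.sqrt (poincareMetric n y).det *
      ∑ j, (poincareMetric n y)⁻¹ i j * partialDeriv j u y) x =
      flatDefining x ^ (1 - n : ℤ) * partialDeriv i (partialDeriv i u) x +
      partialDeriv i u x * (((1 - n : ℤ) : ℝ) * flatDefining x ^ (1 - n - 1 : ℤ) * (- x i)) := by
    intro i
    have e : (fun y => Real.sqrt (poincareMetric n y).det *
        ∑ j, (poincareMetric n y)⁻¹ i j * partialDeriv j u y) =ᶠ[𝓝 x]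
        fun y => flatDefining y ^ (1 - n : ℤ) * partialDeriv i u y := by
      filter_upwards [isOpen_unitBall.mem_nhds hx] with y hy
      have := flatDefining_pos hy
      rw [hdet y hy, hinv y hy]
      simp only [Matrix.smul_apply, Matrix.one_apply, smul_eq_mul, mul_ite, mul_one, mul_zero,
        ite_mul, zero_mul, Finset.sum_ite_eq, Finset.mem_univ, if_true]
      rw [← mul_assoc]
      congr 1
      rw [show (1 - n : ℤ) = 2 - ((n + 1 : ℕ) : ℤ) by push_cast; ring, zpow_sub₀ this.ne',
        zpow_natCast, div_eq_inv_mul]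
      norm_cast
    rw [e.partialDeriv_eq i, partialDeriv_mul i (hW i).differentiableAt
      (hu.differentiableAt_partialDeriv i), partialDeriv_of_hasFDerivAt i (hW i)]
    simp [EuclideanSpace.inner_single_right]
  rw [laplaceBeltrami, hdet x hx, inv_inv, Finset.sum_congr rfl fun i _ => key i, flatLaplacian,
    eulerOperator, Finset.mul_sum, Finset.mul_sum, Finset.mul_sum, ← Finset.sum_add_distrib]
  refine Finset.sum_congr rfl fun i _ => ?_
  have p1 : flatDefining x ^ (n + 1) * flatDefining x ^ (1 - n : ℤ) = flatDefining x ^ 2 := by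
    rw [← zpow_natCast, ← zpow_add₀ hρ.ne', ← zpow_natCast]
    congr 1
    push_cast
    ring
  have p2 : flatDefining x ^ (n + 1) * flatDefining x ^ (1 - n - 1 : ℤ) = flatDefining x := by
    rw [← zpow_natCast, ← zpow_add₀ hρ.ne']
    conv_rhs => rw [← zpow_one (flatDefining x)]
    congr 1
    push_cast
    ring
  push_cast
  linear_combination (partialDeriv i (partialDeriv i u) x) * p1 +
    partialDeriv i u x * (n - 1) * x i * p2

/-! ### Second order conditions at a minimum -/

theorem IsLocalMin.partialDeriv_eq_zero {u : RSpace n → ℝ} {x : RSpace n} (h : IsLocalMin u x)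
    (i : Fin (n + 1)) : partialDeriv i u x = 0 := by
  simp [_root_.partialDeriv, h.fderiv_eq_zero]

/-- Restrict to the coordinate line through `x`. A negative second derivative would make the point a
local maximum as well, hence the restriction locally constant and its second derivative zero. -/
theorem IsLocalMin.partialDeriv_partialDeriv_nonneg {u : RSpace n → ℝ} {x : RSpace n}
    (h : IsLocalMin u x) (hu : ContDiffAt ℝ 2 u x) (i : Fin (n + 1)) :
    0 ≤ _root_.partialDeriv i (_root_.partialDeriv i u) x := by
  set e : RSpace n := EuclideanSpace.single i 1
  set ℓ : ℝ → RSpace n := fun t => x + t • e with hℓ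
  have hℓ0 : ℓ 0 = x := by simp [hℓ]
  have hℓd : ∀ t, HasDerivAt ℓ e t := fun t => by
    simpa only [one_smul] using! ((hasDerivAt_id t).smul_const e).const_add x
  have hℓt : Tendsto ℓ (𝓝 0) (𝓝 x) := by
    have := (hℓd 0).continuousAt.tendsto
    rwa [hℓ0] at this
  have hg : ∀ {v : RSpace n → ℝ} {t : ℝ}, DifferentiableAt ℝ v (ℓ t) →
      HasDerivAt (fun t => v (ℓ t)) (_root_.partialDeriv i v (ℓ t)) t := fun {v t} hv =>
    hv.hasFDerivAt.comp_hasDerivAt t (hℓd t)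
  have hd : deriv (fun t => u (ℓ t)) =ᶠ[𝓝 0] fun t => _root_.partialDeriv i u (ℓ t) := by
    filter_upwards [hℓt.eventually hu.eventually_differentiableAt] with t ht using (hg ht).deriv
  have hdd : deriv (deriv fun t => u (ℓ t)) 0 =
      _root_.partialDeriv i (_root_.partialDeriv i u) x := by
    rw [hd.deriv_eq, (hg (by rw [hℓ0]; exact hu.differentiableAt_partialDeriv i)).deriv, hℓ0]
  have hmin : IsLocalMin (fun t => u (ℓ t)) 0 := by
    have : ∀ᶠ y in 𝓝 x, u x ≤ u y := h
    filter_upwards [hℓt.eventually this] with t ht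
    rwa [hℓ0]
  by_contra hneg
  push Not at hneg
  have hmax : IsLocalMax (fun t => u (ℓ t)) 0 := by
    refine isLocalMax_of_deriv_deriv_neg (by rwa [hdd]) ?_ ?_
    · rw [hd.self_of_nhds]
      simp only [hℓ0]
      rw [h.partialDeriv_eq_zero i]
    · exact (hg (by rw [hℓ0]; exact hu.differentiableAt (by norm_num))).continuousAt
  have hconst : (fun t => u (ℓ t)) =ᶠ[𝓝 0] fun _ => u (ℓ 0) := by
    filter_upwards [hmin, hmax] with t h1 h2 using le_antisymm h2 h1
  have h0 : deriv (deriv fun t => u (ℓ t)) 0 = 0 := by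
    rw [hconst.deriv.deriv_eq]
    simp
  rw [hdd] at h0
  linarith

theorem IsLocalMin.flatLaplacian_nonneg {u : RSpace n → ℝ} {x : RSpace n}
    (h : IsLocalMin u x) (hu : ContDiffAt ℝ 2 u x) : 0 ≤ flatLaplacian u x :=
  Finset.sum_nonneg fun i _ => h.partialDeriv_partialDeriv_nonneg hu i

theorem IsLocalMin.eulerOperator_eq_zero {u : RSpace n → ℝ} {x : RSpace n}
    (h : IsLocalMin u x) : eulerOperator u x = 0 :=
  Finset.sum_eq_zero fun i _ => by rw [h.partialDeriv_eq_zero i, mul_zero]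
end

noncomputable section

/-! ### Integrals depending smoothly on a parameter -/

/-- The integral `∫ f(ξ) K(x, ξ) dμ(ξ)` over a set `S`. -/
def weightedIntegral {E G : Type} [NormedAddCommGroup E] [NormedAddCommGroup G] [NormedSpace ℝ G]
    {S : Set E} [MeasurableSpace E] (μ : Measure S) (f : S → ℝ) (K : E × E → G) (x : E) : G :=
  ∫ ξ : S, f ξ • K (x, ξ) ∂μ

section ParametricIntegral

set_option linter.unusedSectionVars false

variable {E G : Type} [NormedAddCommGroup E] [NormedSpace ℝ E] [ProperSpace E]
  [NormedAddCommGroup G] [NormedSpace ℝ G] {S : Set E} [CompactSpace S]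
  [MeasurableSpace E] [BorelSpace E] {μ : Measure S} [IsFiniteMeasure μ] {f : S → ℝ}
  {K : E × E → G} {U : Set E} {W : Set (E × E)}

theorem ContinuousOn.continuous_comp_prodMk_subtype (hK : ContinuousOn K W)
    (hUW : ∀ x ∈ U, ∀ ξ : S, (x, (ξ : E)) ∈ W) {x : E} (hx : x ∈ U) :
    Continuous fun ξ : S => K (x, (ξ : E)) :=
  hK.comp_continuous (by fun_prop) (hUW x hx)

/-- The product of a small closed ball and `S` is compact. The resulting constant is the dominating
function for continuity and differentiation under the integral. -/
theorem ContinuousOn.exists_nhds_bound (hf : Continuous f) (hK : ContinuousOn K W) (hU : IsOpen U)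
    (hUW : ∀ x ∈ U, ∀ ξ : S, (x, (ξ : E)) ∈ W) {x : E} (hx : x ∈ U) :
    ∃ V ∈ 𝓝 x, V ⊆ U ∧ ∃ C : ℝ, ∀ y ∈ V, ∀ ξ : S, ‖f ξ • K (y, (ξ : E))‖ ≤ C := by
  obtain ⟨r, hr, hrU⟩ := Metric.nhds_basis_closedBall.mem_iff.1 (hU.mem_nhds hx)
  have hc : IsCompact (Metric.closedBall x r ×ˢ (univ : Set S)) :=
    (isCompact_closedBall x r).prod isCompact_univ
  have hcont : ContinuousOn (fun p : E × S => f p.2 • K (p.1, (p.2 : E)))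
      (Metric.closedBall x r ×ˢ (univ : Set S)) := by
    refine (hf.comp continuous_snd).continuousOn.smul (hK.comp (by fun_prop) ?_)
    intro p hp
    exact hUW p.1 (hrU hp.1) p.2
  obtain ⟨C, hC⟩ := hc.exists_bound_of_continuousOn hcont
  exact ⟨Metric.closedBall x r, Metric.closedBall_mem_nhds x hr, hrU, C, fun y hy ξ =>
    hC (y, ξ) ⟨hy, mem_univ ξ⟩⟩

theorem aestronglyMeasurable_weightedIntegrand (hf : Continuous f) (hK : ContinuousOn K W)
    (hUW : ∀ x ∈ U, ∀ ξ : S, (x, (ξ : E)) ∈ W) {x : E} (hx : x ∈ U) :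
    AEStronglyMeasurable (fun ξ : S => f ξ • K (x, (ξ : E))) μ :=
  (hf.smul (hK.continuous_comp_prodMk_subtype hUW hx)).aestronglyMeasurable_of_compactSpace

theorem integrable_weightedIntegrand (hf : Continuous f) (hK : ContinuousOn K W)
    (hUW : ∀ x ∈ U, ∀ ξ : S, (x, (ξ : E)) ∈ W) {x : E} (hx : x ∈ U) :
    Integrable (fun ξ : S => f ξ • K (x, (ξ : E))) μ := by
  have hc := hf.smul (hK.continuous_comp_prodMk_subtype hUW hx)
  obtain ⟨C, hC⟩ := isCompact_univ.exists_bound_of_continuousOn hc.continuousOn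
  exact Integrable.of_bound (aestronglyMeasurable_weightedIntegrand hf hK hUW hx) C
    (Eventually.of_forall fun ξ => hC ξ (mem_univ ξ))

theorem continuousOn_weightedIntegral (hf : Continuous f) (hW : IsOpen W) (hK : ContinuousOn K W)
    (hU : IsOpen U) (hUW : ∀ x ∈ U, ∀ ξ : S, (x, (ξ : E)) ∈ W) :
    ContinuousOn (weightedIntegral μ f K) U := by
  intro x hx
  obtain ⟨V, hV, hVU, C, hC⟩ := hK.exists_nhds_bound hf hU hUW hx
  refine (continuousAt_of_dominated (bound := fun _ => C) ?_ ?_ (integrable_const C)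
    ?_).continuousWithinAt
  · filter_upwards [hV] with y hy using aestronglyMeasurable_weightedIntegrand hf hK hUW (hVU hy)
  · filter_upwards [hV] with y hy using Eventually.of_forall (hC y hy)
  · refine Eventually.of_forall fun ξ => ?_
    have h1 : ContinuousAt K (x, (ξ : E)) := hK.continuousAt (hW.mem_nhds (hUW x hx ξ))
    have h2 : ContinuousAt (fun y : E => (y, (ξ : E))) x := by fun_prop
    exact continuousAt_const.smul (ContinuousAt.comp (f := fun y : E => (y, (ξ : E))) h1 h2)

/-- The partial derivative of `K` in its first variable. -/
def fderivFst (K : E × E → G) (p : E × E) : E →L[ℝ] G :=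
  (fderiv ℝ K p).comp (ContinuousLinearMap.inl ℝ E E)

theorem ContDiffOn.fderivFst {m : WithTop ℕ∞} (hW : IsOpen W) (hK : ContDiffOn ℝ (m + 1) K W) :
    ContDiffOn ℝ m (fderivFst K) W :=
  (hK.fderiv_of_isOpen hW le_rfl).clm_comp contDiffOn_const

theorem DifferentiableAt.hasFDerivAt_prodMk {x y : E} (hK : DifferentiableAt ℝ K (x, y)) :
    HasFDerivAt (fun z => K (z, y)) (_root_.fderivFst K (x, y)) x :=
  hK.hasFDerivAt.comp x (hasFDerivAt_prodMk_left x y)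

theorem hasFDerivAt_weightedIntegral (hf : Continuous f) (hW : IsOpen W) (hK : ContDiffOn ℝ 1 K W)
    (hU : IsOpen U) (hUW : ∀ x ∈ U, ∀ ξ : S, (x, (ξ : E)) ∈ W) {x : E} (hx : x ∈ U) :
    HasFDerivAt (weightedIntegral μ f K) (weightedIntegral μ f (fderivFst K) x) x := by
  have hK' : ContinuousOn (fderivFst K) W := (hK.fderivFst (m := 0) hW).continuousOn
  obtain ⟨V, hV, hVU, C, hC⟩ := hK'.exists_nhds_bound hf hU hUW hx
  refine hasFDerivAt_integral_of_dominated_of_fderiv_le (bound := fun _ => C) hV ?_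
    (integrable_weightedIntegrand hf hK.continuousOn hUW hx)
    (aestronglyMeasurable_weightedIntegrand hf hK' hUW hx)
    (Eventually.of_forall fun ξ y hy => hC y hy ξ) (integrable_const C)
    (Eventually.of_forall fun ξ y hy => ?_)
  · filter_upwards [hV] with y hy
      using aestronglyMeasurable_weightedIntegrand hf hK.continuousOn hUW (hVU hy)
  · have h1 : DifferentiableAt ℝ K (y, (ξ : E)) :=
      (hK.contDiffAt (hW.mem_nhds (hUW y (hVU hy) ξ))).differentiableAt (by norm_num)
    exact h1.hasFDerivAt_prodMk.const_smul (f ξ)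

/-- The derivative is again a weighted integral, with kernel `fderivFst K` valued in continuous
linear maps. The target space must therefore vary in the induction. -/
theorem contDiffOn_weightedIntegral (m : ℕ) (hf : Continuous f) (hW : IsOpen W)
    (hK : ContDiffOn ℝ m K W) (hU : IsOpen U) (hUW : ∀ x ∈ U, ∀ ξ : S, (x, (ξ : E)) ∈ W) :
    ContDiffOn ℝ m (weightedIntegral μ f K) U := by
  induction m generalizing G with
  | zero => exact contDiffOn_zero.2 (continuousOn_weightedIntegral hf hW hK.continuousOn hU hUW)
  | succ m ih =>
    push_cast at hK ⊢
    have h1 : ContDiffOn ℝ 1 K W := hK.of_le (by simp)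
    rw [contDiffOn_succ_iff_fderiv_of_isOpen hU]
    refine ⟨fun x hx => (hasFDerivAt_weightedIntegral hf hW h1 hU
      hUW hx).differentiableAt.differentiableWithinAt, by simp, ?_⟩
    exact (ih (hK.fderivFst hW)).congr fun x hx =>
      (hasFDerivAt_weightedIntegral hf hW h1 hU hUW hx).fderiv

end ParametricIntegral

/-! ### Euler operator and flat Laplacian under the integral sign -/

section PartialDeriv

variable {n : ℕ} {f : UnitSphere n → ℝ} {K : RSpace n × RSpace n → ℝ} {U : Set (RSpace n)}
  {W : Set (RSpace n × RSpace n)}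

instance : IsFiniteMeasure (surfaceMeasure n) := by
  unfold surfaceMeasure
  infer_instance

instance : (surfaceMeasure n).IsOpenPosMeasure := by
  unfold surfaceMeasure
  infer_instance

/-- The `i`-th partial derivative of `K` in its first variable. -/
def partialDerivFst (i : Fin (n + 1)) (K : RSpace n × RSpace n → ℝ) (p : RSpace n × RSpace n) : ℝ :=
  fderivFst K p (EuclideanSpace.single i 1)

theorem ContDiffOn.partialDerivFst {m : WithTop ℕ∞} (i : Fin (n + 1)) (hW : IsOpen W)
    (hK : ContDiffOn ℝ (m + 1) K W) : ContDiffOn ℝ m (partialDerivFst i K) W :=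
  (hK.fderivFst hW).clm_apply contDiffOn_const

theorem partialDerivFst_eq (i : Fin (n + 1)) (hW : IsOpen W) (hK : ContDiffOn ℝ 1 K W)
    {x y : RSpace n} (h : (x, y) ∈ W) :
    partialDerivFst i K (x, y) = partialDeriv i (fun z => K (z, y)) x := by
  have h1 : DifferentiableAt ℝ K (x, y) :=
    (hK.contDiffAt (hW.mem_nhds h)).differentiableAt (by norm_num)
  rw [partialDeriv_of_hasFDerivAt i h1.hasFDerivAt_prodMk]
  rfl

theorem partialDeriv_weightedIntegral (i : Fin (n + 1)) (hf : Continuous f) (hW : IsOpen W)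
    (hK : ContDiffOn ℝ 1 K W) (hU : IsOpen U) (hUW : ∀ x ∈ U, ∀ ξ : UnitSphere n, (x, ↑ξ) ∈ W)
    {x : RSpace n} (hx : x ∈ U) :
    partialDeriv i (weightedIntegral (surfaceMeasure n) f K) x =
      weightedIntegral (surfaceMeasure n) f (partialDerivFst i K) x := by
  have hK' : ContinuousOn (fderivFst K) W := (hK.fderivFst (m := 0) hW).continuousOn
  rw [partialDeriv_of_hasFDerivAt i (hasFDerivAt_weightedIntegral hf hW hK hU hUW hx),
    weightedIntegral, ContinuousLinearMap.integral_apply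
    (integrable_weightedIntegrand hf hK' hUW hx)]
  rfl

theorem eulerOperator_weightedIntegral (hf : Continuous f) (hW : IsOpen W)
    (hK : ContDiffOn ℝ 1 K W) (hU : IsOpen U) (hUW : ∀ x ∈ U, ∀ ξ : UnitSphere n, (x, ↑ξ) ∈ W)
    {x : RSpace n} (hx : x ∈ U) :
    Integrable (fun ξ => f ξ * eulerOperator (fun z => K (z, (ξ : RSpace n))) x)
      (surfaceMeasure n) ∧
    eulerOperator (weightedIntegral (surfaceMeasure n) f K) x =
      ∫ ξ, f ξ * eulerOperator (fun z => K (z, (ξ : RSpace n))) x ∂(surfaceMeasure n) := by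
  have hint : ∀ i, Integrable (fun ξ : UnitSphere n => f ξ * partialDerivFst i K (x, ↑ξ))
      (surfaceMeasure n) := fun i =>
    integrable_weightedIntegrand hf (hK.partialDerivFst (m := 0) i hW).continuousOn hUW hx
  have e : (fun ξ : UnitSphere n => f ξ * eulerOperator (fun z => K (z, (ξ : RSpace n))) x) =
      fun ξ => ∑ i, x i * (f ξ * partialDerivFst i K (x, ↑ξ)) := by
    funext ξ
    simp only [eulerOperator, Finset.mul_sum]
    refine Finset.sum_congr rfl fun i _ => ?_
    rw [partialDerivFst_eq i hW hK (hUW x hx ξ)]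
    ring
  have hI : Integrable (fun ξ => f ξ * eulerOperator (fun z => K (z, (ξ : RSpace n))) x)
      (surfaceMeasure n) := by
    rw [e]
    exact integrable_finsetSum _ fun i _ => (hint i).const_mul _
  refine ⟨hI, ?_⟩
  rw [e, integral_finsetSum _ fun i _ => (hint i).const_mul _]
  simp only [integral_const_mul, eulerOperator]
  exact Finset.sum_congr rfl fun i _ => by
    rw [partialDeriv_weightedIntegral i hf hW hK hU hUW hx]
    rfl

theorem flatLaplacian_weightedIntegral (hf : Continuous f) (hW : IsOpen W)
    (hK : ContDiffOn ℝ 2 K W) (hU : IsOpen U) (hUW : ∀ x ∈ U, ∀ ξ : UnitSphere n, (x, ↑ξ) ∈ W)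
    {x : RSpace n} (hx : x ∈ U) :
    Integrable (fun ξ => f ξ * flatLaplacian (fun z => K (z, (ξ : RSpace n))) x)
      (surfaceMeasure n) ∧
    flatLaplacian (weightedIntegral (surfaceMeasure n) f K) x =
      ∫ ξ, f ξ * flatLaplacian (fun z => K (z, (ξ : RSpace n))) x ∂(surfaceMeasure n) := by
  have hK1 : ContDiffOn ℝ 1 K W := hK.of_le (by norm_num)
  have hKi : ∀ i, ContDiffOn ℝ 1 (partialDerivFst i K) W := fun i =>
    ContDiffOn.partialDerivFst (m := 1) i hW (by norm_num; exact hK)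
  have hint : ∀ i, Integrable (fun ξ : UnitSphere n =>
      f ξ * partialDerivFst i (partialDerivFst i K) (x, ↑ξ)) (surfaceMeasure n) := fun i =>
    integrable_weightedIntegrand hf ((hKi i).partialDerivFst (m := 0) i hW).continuousOn hUW hx
  have e : (fun ξ : UnitSphere n => f ξ * flatLaplacian (fun z => K (z, (ξ : RSpace n))) x) =
      fun ξ => ∑ i, (f ξ * partialDerivFst i (partialDerivFst i K) (x, ↑ξ)) := by
    funext ξ
    simp only [flatLaplacian, Finset.mul_sum]
    refine Finset.sum_congr rfl fun i _ => ?_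
    rw [partialDerivFst_eq i hW (hKi i) (hUW x hx ξ)]
    congr 1
    refine Filter.EventuallyEq.partialDeriv_eq i ?_
    filter_upwards [hU.mem_nhds hx] with y hy
    rw [partialDerivFst_eq i hW hK1 (hUW y hy ξ)]
  refine ⟨?_, ?_⟩
  · rw [e]
    exact integrable_finsetSum _ fun i _ => hint i
  · rw [e, integral_finsetSum _ fun i _ => hint i]
    simp only [flatLaplacian]
    refine Finset.sum_congr rfl fun i _ => ?_
    have e2 : partialDeriv i (weightedIntegral (surfaceMeasure n) f K) =ᶠ[𝓝 x]
        weightedIntegral (surfaceMeasure n) f (partialDerivFst i K) := by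
      filter_upwards [hU.mem_nhds hx] with y hy
        using partialDeriv_weightedIntegral i hf hW hK1 hU hUW hy
    rw [e2.partialDeriv_eq i, partialDeriv_weightedIntegral i hf hW (hKi i) hU hUW hx]
    rfl

end PartialDeriv

/-! ### The Poisson kernel -/

variable {n : ℕ}

/-- The unnormalized Poisson kernel `((1 - |x|²) / |x - y|²)^s`. -/
def ballPoissonKernel (s : ℝ) (p : RSpace n × RSpace n) : ℝ :=
  ((1 - ‖p.1‖ ^ 2) / ‖p.1 - p.2‖ ^ 2) ^ s

/-- The domain where the Poisson kernel is smooth. -/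
def poissonDomain (n : ℕ) : Set (RSpace n × RSpace n) := {p | ‖p.1‖ < 1 ∧ p.1 ≠ p.2}

theorem isOpen_poissonDomain : IsOpen (poissonDomain n) :=
  (isOpen_lt (f := fun p : RSpace n × RSpace n => ‖p.1‖) (by fun_prop) continuous_const).inter
    (isOpen_ne_fun continuous_fst continuous_snd)

theorem mem_poissonDomain (x : RSpace n) (hx : x ∈ unitBall n) (ξ : UnitSphere n) :
    (x, (ξ : RSpace n)) ∈ poissonDomain n := by
  rw [mem_unitBall] at hx
  refine ⟨hx, fun h => ?_⟩
  have h2 := norm_eq_of_mem_sphere ξ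
  simp only at h
  rw [← h] at h2
  exact hx.ne h2

theorem one_sub_norm_sq_pos {x : RSpace n} (hx : ‖x‖ < 1) : 0 < 1 - ‖x‖ ^ 2 := by
  nlinarith [norm_nonneg x]

theorem norm_sub_sq_pos {x y : RSpace n} (h : x ≠ y) : 0 < ‖x - y‖ ^ 2 := by
  have := norm_pos_iff.2 (sub_ne_zero.2 h)
  positivity

theorem contDiffOn_poissonKernel (s : ℝ) : ContDiffOn ℝ 2 (ballPoissonKernel s) (poissonDomain n) := by
  rintro ⟨x, y⟩ ⟨hx, hxy⟩
  have h1 := one_sub_norm_sq_pos hx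
  have h2 := norm_sub_sq_pos hxy
  refine ContDiffAt.contDiffWithinAt ?_
  refine ContDiffAt.rpow_const_of_ne (ContDiffAt.div ?_ ?_ h2.ne') (by positivity)
  · exact contDiffAt_const.sub (contDiffAt_fst.norm_sq ℝ)
  · exact (contDiffAt_fst.sub contDiffAt_snd).norm_sq ℝ

theorem ballPoissonKernel_pos (s : ℝ) {x y : RSpace n} (h : (x, y) ∈ poissonDomain n) :
    0 < ballPoissonKernel s (x, y) :=
  Real.rpow_pos_of_pos (div_pos (one_sub_norm_sq_pos h.1) (norm_sub_sq_pos h.2)) s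

/-- The hyperbolic operator `ρ₀² Δ + (n - 1) ρ₀ x·∇`, which is the Laplace-Beltrami operator of the
Poincaré metric on functions of class `C²`. -/
def hyperbolicLaplacian (u : RSpace n → ℝ) (x : RSpace n) : ℝ :=
  flatDefining x ^ 2 * flatLaplacian u x + (n - 1) * flatDefining x * eulerOperator u x

theorem hasDerivAt_one_sub_rpow (s : ℝ) {t : ℝ} (ht : t < 1) :
    HasDerivAt (fun t => (1 - t) ^ s) (-(s * (1 - t) ^ (s - 1))) t := by
  convert! ((hasDerivAt_id t).const_sub 1).rpow_const (p := s)
    (Or.inl (by simp only [id]; linarith)) using 1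
  simp only [id]
  ring

theorem flatLaplacian_congr {u v : RSpace n → ℝ} {x : RSpace n} (h : u =ᶠ[𝓝 x] v) :
    flatLaplacian u x = flatLaplacian v x :=
  Finset.sum_congr rfl fun i _ => (h.partialDeriv i).partialDeriv_eq i

theorem eulerOperator_congr {u v : RSpace n → ℝ} {x : RSpace n} (h : u =ᶠ[𝓝 x] v) :
    eulerOperator u x = eulerOperator v x :=
  Finset.sum_congr rfl fun i _ => by rw [h.partialDeriv_eq i]

theorem hyperbolicLaplacian_congr {u v : RSpace n → ℝ} {x : RSpace n} (h : u =ᶠ[𝓝 x] v) :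
    hyperbolicLaplacian u x = hyperbolicLaplacian v x := by
  rw [hyperbolicLaplacian, hyperbolicLaplacian, flatLaplacian_congr h, eulerOperator_congr h]

/-- The kernel is a product of two radial functions, `(1 - |x|²)^s` about the origin and `|x -
ξ|^{-2s}` about `ξ`. All derivatives then depend on `|x|²`, `|x - ξ|²` and the inner product of `x`
with `x - ξ`, and the claim becomes a rational identity. -/
theorem hyperbolicLaplacian_poissonKernel (s : ℝ) {x : RSpace n} (hx : x ∈ unitBall n)
    (ξ : UnitSphere n) :
    hyperbolicLaplacian (fun z => ballPoissonKernel s (z, (ξ : RSpace n))) x =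
      -(s * (n - s)) * ballPoissonKernel s (x, (ξ : RSpace n)) := by
  have hξ : ‖(ξ : RSpace n)‖ = 1 := norm_eq_of_mem_sphere ξ
  have hmem := mem_poissonDomain x hx ξ
  have hx1 := mem_unitBall.1 hx
  have hA := one_sub_norm_sq_pos hx1
  have hq := norm_sub_sq_pos hmem.2
  set y : RSpace n := (ξ : RSpace n)
  set H : ℝ → ℝ := fun t => (1 - t) ^ s
  set H1 : ℝ → ℝ := fun t => -(s * (1 - t) ^ (s - 1))
  set J : ℝ → ℝ := fun q => q ^ (-s)
  set J1 : ℝ → ℝ := fun q => -s * q ^ (-s - 1)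
  have e : (fun z => ballPoissonKernel s (z, y)) =ᶠ[𝓝 x] fun z => H (‖z - 0‖ ^ 2) * J (‖z - y‖ ^ 2) := by
    filter_upwards [isOpen_unitBall.mem_nhds hx] with z hz
    have h1 := one_sub_norm_sq_pos (mem_unitBall.1 hz)
    have h2 := norm_sub_sq_pos (mem_poissonDomain z hz ξ).2
    simp only [ballPoissonKernel, H, J, sub_zero]
    rw [Real.div_rpow h1.le h2.le, Real.rpow_neg h2.le]
    rfl
  have hx0 : ‖x - 0‖ ^ 2 < 1 := by rw [sub_zero]; linarith
  have hH : ∀ᶠ q in 𝓝 (‖x - 0‖ ^ 2), HasDerivAt H (H1 q) q := by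
    filter_upwards [gt_mem_nhds hx0] with t ht using hasDerivAt_one_sub_rpow s ht
  have hH1 : HasDerivAt H1 (s * (s - 1) * (1 - ‖x - 0‖ ^ 2) ^ (s - 1 - 1)) (‖x - 0‖ ^ 2) := by
    convert! ((hasDerivAt_one_sub_rpow (s - 1) hx0).const_mul s).neg using 1
    ring
  have hJ : ∀ᶠ q in 𝓝 (‖x - y‖ ^ 2), HasDerivAt J (J1 q) q := by
    filter_upwards [lt_mem_nhds hq] with t ht using Real.hasDerivAt_rpow_const (Or.inl ht.ne')
  have hJ1 : HasDerivAt J1 (-s * ((-s - 1) * (‖x - y‖ ^ 2) ^ (-s - 1 - 1))) (‖x - y‖ ^ 2) :=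
    (Real.hasDerivAt_rpow_const (Or.inl hq.ne')).const_mul (-s)
  have cH : ContDiffAt ℝ 2 (fun z : RSpace n => H (‖z - 0‖ ^ 2)) x :=
    contDiffAt_radial 0 ((contDiffAt_const.sub contDiffAt_id).rpow_const_of_ne
      (by simp only [id]; linarith))
  have cJ : ContDiffAt ℝ 2 (fun z : RSpace n => J (‖z - y‖ ^ 2)) x :=
    contDiffAt_radial y (contDiffAt_id.rpow_const_of_ne hq.ne')
  have dH := cH.differentiableAt (by norm_num : (2 : WithTop ℕ∞) ≠ 0)
  have dJ := cJ.differentiableAt (by norm_num : (2 : WithTop ℕ∞) ≠ 0)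
  have hsum : ∑ i, partialDeriv i (fun z : RSpace n => H (‖z - 0‖ ^ 2)) x *
      partialDeriv i (fun z : RSpace n => J (‖z - y‖ ^ 2)) x =
      4 * inner ℝ x (x - y) * H1 (‖x - 0‖ ^ 2) * J1 (‖x - y‖ ^ 2) := by
    simp only [partialDeriv_radial _ _ hH.self_of_nhds, partialDeriv_radial _ _ hJ.self_of_nhds,
      PiLp.inner_apply, Finset.mul_sum, Finset.sum_mul]
    refine Finset.sum_congr rfl fun i _ => ?_
    simp
    ring
  -- Law of cosines; this is where `|ξ| = 1` enters and eliminates the last independent quantity.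
  have hin : inner ℝ x (x - y) = (‖x‖ ^ 2 + ‖x - y‖ ^ 2 - 1) / 2 := by
    have := norm_sub_sq_real x (x - y)
    rw [sub_sub_cancel, hξ] at this
    linarith
  have hk : ballPoissonKernel s (x, y) = H (‖x - 0‖ ^ 2) * J (‖x - y‖ ^ 2) := e.self_of_nhds
  rw [hyperbolicLaplacian_congr e, hyperbolicLaplacian, flatLaplacian_mul cH cJ,
    eulerOperator_mul dH dJ, flatLaplacian_radial 0 hH hH1, flatLaplacian_radial y hJ hJ1,
    eulerOperator_radial 0 hH.self_of_nhds, eulerOperator_radial y hJ.self_of_nhds, hsum, hk, hin]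
  simp only [H, H1, J, J1, sub_zero, flatDefining, real_inner_self_eq_norm_sq]
  generalize ‖x‖ ^ 2 = t at *
  generalize ‖x - y‖ ^ 2 = q at *
  simp only [Real.rpow_sub_one hA.ne', Real.rpow_sub_one hq.ne']
  generalize (1 - t) ^ s = a
  generalize q ^ (-s) = b
  obtain ⟨A, rfl⟩ : ∃ A, t = 1 - A := ⟨1 - t, by ring⟩
  simp only [sub_sub_cancel] at hA ⊢
  field_simp
  ring

/-- Poisson integrals solve the equation. -/
theorem hyperbolicLaplacian_weightedIntegral (s : ℝ) {f : UnitSphere n → ℝ} (hf : Continuous f)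
    {x : RSpace n} (hx : x ∈ unitBall n) :
    hyperbolicLaplacian (weightedIntegral (surfaceMeasure n) f (ballPoissonKernel s)) x =
      -(s * (n - s)) * weightedIntegral (surfaceMeasure n) f (ballPoissonKernel s) x := by
  have hK := contDiffOn_poissonKernel (n := n) s
  obtain ⟨hI1, h1⟩ := flatLaplacian_weightedIntegral hf isOpen_poissonDomain hK isOpen_unitBall
    mem_poissonDomain hx
  obtain ⟨hI2, h2⟩ := eulerOperator_weightedIntegral hf isOpen_poissonDomain
    (hK.of_le (by norm_num)) isOpen_unitBall mem_poissonDomain hx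
  rw [hyperbolicLaplacian, h1, h2, ← integral_const_mul, ← integral_const_mul,
    ← integral_add (hI1.const_mul _) (hI2.const_mul _), weightedIntegral, ← integral_const_mul]
  refine integral_congr_ae (Eventually.of_forall fun ξ => ?_)
  have := hyperbolicLaplacian_poissonKernel s hx ξ
  rw [hyperbolicLaplacian] at this
  simp only [smul_eq_mul]
  linear_combination f ξ * this

theorem contDiffOn_poissonIntegral (s : ℝ) {f : UnitSphere n → ℝ} (hf : Continuous f) :
    ContDiffOn ℝ 2 (weightedIntegral (surfaceMeasure n) f (ballPoissonKernel s)) (unitBall n) :=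
  contDiffOn_weightedIntegral 2 hf isOpen_poissonDomain (contDiffOn_poissonKernel s) isOpen_unitBall
    mem_poissonDomain
end

noncomputable section

variable {n : ℕ}

/-! ### Solutions and the maximum principle -/

theorem ContDiffOn.contDiffAt_of_mem_unitBall {u : RSpace n → ℝ} (hu : ContDiffOn ℝ 2 u (unitBall n))
    {x : RSpace n} (hx : x ∈ unitBall n) : ContDiffAt ℝ 2 u x :=
  hu.contDiffAt (isOpen_unitBall.mem_nhds hx)

theorem hyperbolicLaplacian_sub {u v : RSpace n → ℝ} {x : RSpace n} (hu : ContDiffAt ℝ 2 u x)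
    (hv : ContDiffAt ℝ 2 v x) : hyperbolicLaplacian (fun y => u y - v y) x =
      hyperbolicLaplacian u x - hyperbolicLaplacian v x := by
  simp only [hyperbolicLaplacian, flatLaplacian_sub hu hv,
    eulerOperator_sub (hu.differentiableAt (by norm_num)) (hv.differentiableAt (by norm_num))]
  ring

theorem hyperbolicLaplacian_add {u v : RSpace n → ℝ} {x : RSpace n} (hu : ContDiffAt ℝ 2 u x)
    (hv : ContDiffAt ℝ 2 v x) : hyperbolicLaplacian (fun y => u y + v y) x =
      hyperbolicLaplacian u x + hyperbolicLaplacian v x := by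
  simp only [hyperbolicLaplacian, flatLaplacian_add hu hv,
    eulerOperator_add (hu.differentiableAt (by norm_num)) (hv.differentiableAt (by norm_num))]
  ring

theorem hyperbolicLaplacian_const_mul {u : RSpace n → ℝ} {x : RSpace n} (c : ℝ)
    (hu : ContDiffAt ℝ 2 u x) : hyperbolicLaplacian (fun y => c * u y) x =
      c * hyperbolicLaplacian u x := by
  simp only [hyperbolicLaplacian, flatLaplacian_const_mul c hu,
    eulerOperator_const_mul c (hu.differentiableAt (by norm_num))]
  ring

/-- `u ∈ C²` solves `-Δ₊ u - s (n - s) u = 0` in the ball. -/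
structure IsBallSolution (s : ℝ) (u : RSpace n → ℝ) : Prop where
  contDiffOn : ContDiffOn ℝ 2 u (unitBall n)
  equation : ∀ x ∈ unitBall n, hyperbolicLaplacian u x = -(s * (n - s)) * u x

/-- `Q ∈ C²` is a positive strict supersolution of `-Δ₊ u - s (n - s) u = 0` in the ball. -/
structure IsBallSupersolution (s : ℝ) (Q : RSpace n → ℝ) : Prop where
  contDiffOn : ContDiffOn ℝ 2 Q (unitBall n)
  pos : ∀ x ∈ unitBall n, 0 < Q x
  lt : ∀ x ∈ unitBall n, hyperbolicLaplacian Q x < -(s * (n - s)) * Q x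

theorem isBallSolution_iff {s : ℝ} {u : RSpace n → ℝ} : IsBallSolution s u ↔
    ContDiffOn ℝ 2 u (unitBall n) ∧ ∀ x ∈ unitBall n,
      -laplaceBeltrami (poincareMetric n) u x - s * ((n : ℝ) - s) * u x = 0 := by
  constructor
  · rintro ⟨h1, h2⟩
    refine ⟨h1, fun x hx => ?_⟩
    have := h2 x hx
    rw [laplaceBeltrami_poincareMetric hx (h1.contDiffAt_of_mem_unitBall hx)]
    rw [hyperbolicLaplacian] at this
    linarith
  · rintro ⟨h1, h2⟩
    refine ⟨h1, fun x hx => ?_⟩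
    have := h2 x hx
    rw [laplaceBeltrami_poincareMetric hx (h1.contDiffAt_of_mem_unitBall hx)] at this
    rw [hyperbolicLaplacian]
    linarith

namespace IsBallSolution

variable {s : ℝ} {u v : RSpace n → ℝ}

theorem sub (hu : IsBallSolution s u) (hv : IsBallSolution s v) :
    IsBallSolution s (fun x => u x - v x) where
  contDiffOn := hu.contDiffOn.sub hv.contDiffOn
  equation x hx := by
    rw [hyperbolicLaplacian_sub (hu.contDiffOn.contDiffAt_of_mem_unitBall hx)
      (hv.contDiffOn.contDiffAt_of_mem_unitBall hx), hu.equation x hx, hv.equation x hx]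
    ring

theorem const_mul (c : ℝ) (hu : IsBallSolution s u) : IsBallSolution s (fun x => c * u x) where
  contDiffOn := contDiffOn_const.mul hu.contDiffOn
  equation x hx := by
    rw [hyperbolicLaplacian_const_mul c (hu.contDiffOn.contDiffAt_of_mem_unitBall hx),
      hu.equation x hx]
    ring

end IsBallSolution

/-- At a local minimum the gradient vanishes and the operator reduces to `ρ₀² Δ`, which is
nonnegative there. Since `M Q - v` vanishes at the point, the strict supersolution inequality makes
the same quantity negative. -/
theorem not_isLocalMin_supersolution_sub {s M : ℝ} {v Q : RSpace n → ℝ} (hv : IsBallSolution s v)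
    (hQ : IsBallSupersolution s Q) (hM : 0 < M) {x : RSpace n} (hx : x ∈ unitBall n)
    (h0 : M * Q x = v x) : ¬ IsLocalMin (fun y => M * Q y - v y) x := by
  intro hmin
  have cQ := hQ.contDiffOn.contDiffAt_of_mem_unitBall hx
  have cv := hv.contDiffOn.contDiffAt_of_mem_unitBall hx
  have cM : ContDiffAt ℝ 2 (fun y => M * Q y) x := contDiffAt_const.mul cQ
  have h1 : 0 ≤ hyperbolicLaplacian (fun y => M * Q y - v y) x := by
    rw [hyperbolicLaplacian, hmin.eulerOperator_eq_zero, mul_zero, add_zero]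
    exact mul_nonneg (sq_nonneg _) (hmin.flatLaplacian_nonneg (cM.sub cv))
  rw [hyperbolicLaplacian_sub cM cv, hyperbolicLaplacian_const_mul M cQ, hv.equation x hx,
    ← h0] at h1
  have h2 := mul_lt_mul_of_pos_left (hQ.lt x hx) hM
  linarith

/-- The comparison principle on the ball of radius `R < 1`. -/
theorem IsBallSolution.le_of_le_on_sphere {s M R : ℝ} {v Q : RSpace n → ℝ}
    (hv : IsBallSolution s v) (hQ : IsBallSupersolution s Q) (hM : 0 ≤ M) (hR : R < 1)
    (hb : ∀ x, ‖x‖ = R → v x ≤ M * Q x) {x : RSpace n} (hx : ‖x‖ ≤ R) : v x ≤ M * Q x := by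
  have hsub : Metric.closedBall (0 : RSpace n) R ⊆ unitBall n := Metric.closedBall_subset_ball hR
  have hcont : ContinuousOn (fun y => v y / Q y) (Metric.closedBall (0 : RSpace n) R) :=
    (hv.contDiffOn.continuousOn.mono hsub).div (hQ.contDiffOn.continuousOn.mono hsub)
      fun y hy => (hQ.pos y (hsub hy)).ne'
  -- Maximize the quotient, not `v`: the zero-order term may have the wrong sign for `v` itself. If
  -- the maximum value `m` exceeds `M ≥ 0`, it is attained in the interior, and there `m Q - v` has
  -- a local minimum with value zero.
  obtain ⟨x₀, hx₀, hmax⟩ := (isCompact_closedBall (0 : RSpace n) R).exists_isMaxOn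
    ⟨x, by simpa using hx⟩ hcont
  have hle : ∀ y ∈ Metric.closedBall (0 : RSpace n) R, v y ≤ v x₀ / Q x₀ * Q y := fun y hy =>
    (div_le_iff₀ (hQ.pos y (hsub hy))).1 (hmax hy)
  have hxm : x ∈ Metric.closedBall (0 : RSpace n) R := by simpa using hx
  by_cases hM' : v x₀ / Q x₀ ≤ M
  · exact (hle x hxm).trans (mul_le_mul_of_nonneg_right hM' (hQ.pos x (hsub hxm)).le)
  · exfalso
    push Not at hM'
    have hQ0 := hQ.pos x₀ (hsub hx₀)
    have hx₀R : ‖x₀‖ < R := by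
      refine lt_of_le_of_ne (by simpa using hx₀) fun h => ?_
      exact absurd ((div_le_iff₀ hQ0).2 (hb x₀ h)) (not_le.2 hM')
    refine not_isLocalMin_supersolution_sub hv hQ (hM.trans_lt hM') (hsub hx₀)
      (div_mul_cancel₀ _ hQ0.ne') ?_
    filter_upwards [Metric.isOpen_ball.mem_nhds (by simpa using hx₀R :
      x₀ ∈ Metric.ball (0 : RSpace n) R)] with y hy
    rw [div_mul_cancel₀ _ hQ0.ne', sub_self, sub_nonneg]
    exact hle y (Metric.ball_subset_closedBall hy)

theorem IsBallSolution.eq_zero_of_eq_zero_on_sphere {s R : ℝ} {v Q : RSpace n → ℝ}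
    (hv : IsBallSolution s v) (hQ : IsBallSupersolution s Q) (hR : R < 1)
    (hb : ∀ x, ‖x‖ = R → v x = 0) {x : RSpace n} (hx : ‖x‖ ≤ R) : v x = 0 := by
  have h1 := hv.le_of_le_on_sphere hQ le_rfl hR (fun y hy => by rw [hb y hy, zero_mul]) hx
  have h2 := (hv.const_mul (-1)).le_of_le_on_sphere hQ le_rfl hR
    (fun y hy => by rw [hb y hy, mul_zero, zero_mul]) hx
  linarith

/-! ### Separated solutions -/

/-- Harmonicity kills `Δp`, and Euler's identity `x·∇p = l p` handles both the first-order term and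
the cross term `∇H·∇p = 2 H' x·∇p`, so `p` factors out. -/
theorem hyperbolicLaplacian_radial_mul_polyFun {l : ℕ} {p : MvPolynomial (Fin (n + 1)) ℝ}
    (hp : p.IsHomogeneous l) (hΔ : ∑ i, MvPolynomial.pderiv i (MvPolynomial.pderiv i p) = 0)
    {H H1 : ℝ → ℝ} {H2 : ℝ} {x : RSpace n} (cH : ContDiffAt ℝ 2 H (‖x‖ ^ 2))
    (hH : ∀ᶠ q in 𝓝 (‖x‖ ^ 2), HasDerivAt H (H1 q) q) (hH1 : HasDerivAt H1 H2 (‖x‖ ^ 2)) :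
    hyperbolicLaplacian (fun z => H (‖z‖ ^ 2) * polyFun p z) x = polyFun p x *
      (flatDefining x ^ 2 * (4 * ‖x‖ ^ 2 * H2 + (2 * (n + 1) + 4 * l) * H1 (‖x‖ ^ 2)) +
      (n - 1) * flatDefining x * (2 * ‖x‖ ^ 2 * H1 (‖x‖ ^ 2) + l * H (‖x‖ ^ 2))) := by
  rw [← sub_zero x] at cH hH hH1
  have cH' := contDiffAt_radial 0 cH
  have cp : ContDiffAt ℝ 2 (polyFun p) x := (contDiff_polyFun p).contDiffAt
  have hl := flatLaplacian_radial 0 hH hH1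
  have he := eulerOperator_radial 0 hH.self_of_nhds
  have hsum : ∑ i, partialDeriv i (fun z : RSpace n => H (‖z - 0‖ ^ 2)) x *
      partialDeriv i (polyFun p) x = 2 * H1 (‖x - 0‖ ^ 2) * eulerOperator (polyFun p) x := by
    simp only [partialDeriv_radial _ _ hH.self_of_nhds, eulerOperator, Finset.mul_sum]
    refine Finset.sum_congr rfl fun i _ => ?_
    simp
    ring
  simp only [sub_zero] at cH' hl he hsum
  rw [hyperbolicLaplacian, flatLaplacian_mul cH' cp, eulerOperator_mul
    (cH'.differentiableAt (by norm_num)) (differentiableAt_polyFun p x), hl, he, hsum,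
    flatLaplacian_polyFun hΔ, eulerOperator_polyFun hp, real_inner_self_eq_norm_sq]
  ring

theorem hyperbolicLaplacian_radial {H H1 : ℝ → ℝ} {H2 : ℝ} {x : RSpace n}
    (cH : ContDiffAt ℝ 2 H (‖x‖ ^ 2)) (hH : ∀ᶠ q in 𝓝 (‖x‖ ^ 2), HasDerivAt H (H1 q) q)
    (hH1 : HasDerivAt H1 H2 (‖x‖ ^ 2)) :
    hyperbolicLaplacian (fun z => H (‖z‖ ^ 2)) x =
      flatDefining x ^ 2 * (4 * ‖x‖ ^ 2 * H2 + 2 * (n + 1) * H1 (‖x‖ ^ 2)) +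
      (n - 1) * flatDefining x * (2 * ‖x‖ ^ 2 * H1 (‖x‖ ^ 2)) := by
  have := hyperbolicLaplacian_radial_mul_polyFun (n := n) (MvPolynomial.isHomogeneous_one _ ℝ)
    (by simp) cH hH hH1
  simpa [polyFun] using this

theorem norm_sq_lt_one {x : RSpace n} (hx : x ∈ unitBall n) : ‖x‖ ^ 2 < 1 := by
  have := one_sub_norm_sq_pos (mem_unitBall.1 hx)
  linarith

theorem contDiffAt_one_sub_rpow (a : ℝ) {t : ℝ} (ht : t < 1) :
    ContDiffAt ℝ 2 (fun t : ℝ => (1 - t) ^ a) t :=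
  (contDiffAt_const.sub contDiffAt_id).rpow_const_of_ne (by simp only [id]; linarith)

theorem hasDerivAt_deriv_one_sub_rpow (a : ℝ) {t : ℝ} (ht : t < 1) :
    HasDerivAt (fun t => -(a * (1 - t) ^ (a - 1))) (a * (a - 1) * (1 - t) ^ (a - 1 - 1)) t := by
  convert! ((hasDerivAt_one_sub_rpow (a - 1) ht).const_mul a).neg using 1
  ring

/-- A positive solution plus `ρ₀^{n/2}` is a strict supersolution. -/
theorem IsBallSolution.isBallSupersolution_add {γ : ℝ} (hγ : γ ≠ 0) {P : RSpace n → ℝ}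
    (hP : IsBallSolution (n / 2 + γ) P) (hpos : ∀ x ∈ unitBall n, 0 < P x) :
    IsBallSupersolution (n / 2 + γ) (fun x => P x + (1 - ‖x‖ ^ 2) ^ ((n : ℝ) / 2)) := by
  have hc : ∀ x ∈ unitBall n, ContDiffAt ℝ 2 (fun x => (1 - ‖x‖ ^ 2) ^ ((n : ℝ) / 2)) x := by
    intro x hx
    have := contDiffAt_radial (x := x) 0 (contDiffAt_one_sub_rpow ((n : ℝ) / 2)
      (by rw [sub_zero]; exact norm_sq_lt_one hx))
    simpa only [sub_zero] using this
  refine ⟨hP.contDiffOn.add fun x hx => (hc x hx).contDiffWithinAt, fun x hx => ?_, fun x hx => ?_⟩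
  · have h1 := one_sub_norm_sq_pos (mem_unitBall.1 hx)
    have := hpos x hx
    positivity
  · have h1 := one_sub_norm_sq_pos (mem_unitBall.1 hx)
    have ht := norm_sq_lt_one hx
    rw [hyperbolicLaplacian_add (hP.contDiffOn.contDiffAt_of_mem_unitBall hx) (hc x hx),
      hP.equation x hx, hyperbolicLaplacian_radial (H := fun t => (1 - t) ^ ((n : ℝ) / 2))
      (contDiffAt_one_sub_rpow _ ht)
      ((gt_mem_nhds ht).mono fun t ht => hasDerivAt_one_sub_rpow _ ht)
      (hasDerivAt_deriv_one_sub_rpow _ ht), flatDefining]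
    simp only [Real.rpow_sub_one h1.ne']
    have ha : 0 < (1 - ‖x‖ ^ 2) ^ ((n : ℝ) / 2) := by positivity
    generalize (1 - ‖x‖ ^ 2) ^ ((n : ℝ) / 2) = a at *
    -- The function `a = (1 - |x|²)^{n/2}` satisfies `Δ₊ a ≤ -(n²/4) a`, while `-s(n - s) = γ² -
    -- n²/4`; the strict gap is `γ² a`.
    have key : ((1 - ‖x‖ ^ 2) / 2) ^ 2 * (4 * ‖x‖ ^ 2 * ((n : ℝ) / 2 * (n / 2 - 1) *
        (a / (1 - ‖x‖ ^ 2) / (1 - ‖x‖ ^ 2))) + 2 * (n + 1) * -(n / 2 * (a / (1 - ‖x‖ ^ 2)))) +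
        (n - 1) * ((1 - ‖x‖ ^ 2) / 2) * (2 * ‖x‖ ^ 2 * -(n / 2 * (a / (1 - ‖x‖ ^ 2)))) =
        -(n ^ 2 / 4 * a) - n / 4 * a * (1 - ‖x‖ ^ 2) := by
      field_simp
      ring
    rw [key]
    have h3 : 0 < γ ^ 2 * a := by positivity
    have h4 : 0 ≤ n / 4 * a * (1 - ‖x‖ ^ 2) := by positivity
    nlinarith

/-- The separated solution `(1 - |x|²)^{n/2-γ} F_l(|x|²) p(x)`. -/
def ballMode (n : ℕ) (γ : ℝ) (l : ℕ) (p : MvPolynomial (Fin (n + 1)) ℝ) (x : RSpace n) : ℝ :=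
  (1 - ‖x‖ ^ 2) ^ ((n : ℝ) / 2 - γ) * radialHypergeometric n γ l (‖x‖ ^ 2) * polyFun p x

/-- Factoring out the boundary power `(1 - t)^{n-s}` with `t = |x|²` turns the separated equation
into the hypergeometric equation for `F_l`. -/
theorem isBallSolution_ballMode {γ : ℝ} (hγ : 0 < γ) {l : ℕ} {p : MvPolynomial (Fin (n + 1)) ℝ}
    (hp : p.IsHomogeneous l) (hΔ : ∑ i, MvPolynomial.pderiv i (MvPolynomial.pderiv i p) = 0) :
    IsBallSolution (n / 2 + γ) (ballMode n γ l p) := by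
  obtain ⟨F1, F2, hF⟩ := exists_deriv_radialHypergeometric hγ n l
  set α : ℝ := (n : ℝ) / 2 - γ with hα
  have habs : ∀ {t : ℝ}, t ∈ Ioo (-1 : ℝ) 1 → |t| < 1 := fun ht => abs_lt.2 ht
  have hmem : ∀ x ∈ unitBall n, ‖x‖ ^ 2 ∈ Ioo (-1 : ℝ) 1 := fun x hx =>
    ⟨by linarith [sq_nonneg ‖x‖], norm_sq_lt_one hx⟩
  have cH : ∀ x ∈ unitBall n, ContDiffAt ℝ 2
      (fun t => (1 - t) ^ α * radialHypergeometric n γ l t) (‖x‖ ^ 2) := fun x hx =>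
    (contDiffAt_one_sub_rpow α (norm_sq_lt_one hx)).mul
      ((contDiffOn_radialHypergeometric hγ n l).contDiffAt (isOpen_Ioo.mem_nhds (hmem x hx)))
  refine ⟨fun x hx => ContDiffAt.contDiffWithinAt ?_, fun x hx => ?_⟩
  · have := contDiffAt_radial (x := x) 0 (by rw [sub_zero]; exact cH x hx)
    simp only [sub_zero] at this
    exact this.mul (contDiff_polyFun p).contDiffAt
  · have ht := hmem x hx
    have h1 := one_sub_norm_sq_pos (mem_unitBall.1 hx)
    have hH : ∀ t ∈ Ioo (-1 : ℝ) 1, HasDerivAt (fun t => (1 - t) ^ α * radialHypergeometric n γ l t)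
        (-(α * (1 - t) ^ (α - 1)) * radialHypergeometric n γ l t + (1 - t) ^ α * F1 t) t :=
      fun t ht => (hasDerivAt_one_sub_rpow α ht.2).mul (hF t (habs ht)).1
    have hH1 := ((hasDerivAt_deriv_one_sub_rpow α ht.2).mul (hF _ (habs ht)).1).add
      ((hasDerivAt_one_sub_rpow α ht.2).mul (hF _ (habs ht)).2.1)
    have hode := (hF _ (habs ht)).2.2
    unfold ballMode
    rw [hyperbolicLaplacian_radial_mul_polyFun hp hΔ (cH x hx)
      (Filter.mem_of_superset (isOpen_Ioo.mem_nhds ht) hH) hH1, flatDefining]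
    simp only [Real.rpow_sub_one h1.ne']
    generalize (1 - ‖x‖ ^ 2) ^ α = a
    generalize radialHypergeometric n γ l (‖x‖ ^ 2) = G0 at *
    generalize F1 (‖x‖ ^ 2) = G1 at *
    generalize F2 (‖x‖ ^ 2) = G2 at *
    generalize polyFun p x = P
    generalize ‖x‖ ^ 2 = t at *
    -- With `γ` expressed through `α` and `t` through `A = 1 - t`, the goal is a polynomial multiple
    -- of the hypergeometric equation.
    have hγα : γ = n / 2 - α := by rw [hα]; ring
    rw [hγα] at hode ⊢
    obtain ⟨A, rfl⟩ : ∃ A, t = 1 - A := ⟨1 - t, by ring⟩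
    simp only [sub_sub_cancel] at h1 hode ⊢
    field_simp at hode ⊢
    linear_combination A * P * a * hode
end

noncomputable section

open scoped Pointwise

variable {n : ℕ}

/-! ### Rotation invariance of the surface measure -/

/-- The action of a linear isometry on the unit sphere. -/
def sphereMap (L : RSpace n ≃ₗᵢ[ℝ] RSpace n) (ξ : UnitSphere n) : UnitSphere n :=
  ⟨L ξ, by simp⟩

theorem continuous_sphereMap (L : RSpace n ≃ₗᵢ[ℝ] RSpace n) : Continuous (sphereMap L) :=
  (L.continuous.comp continuous_subtype_val).subtype_mk _

/-- The surface measure of a set is a dimensional constant times the volume of the cone over it. A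
linear isometry carries cones to cones and preserves volume. -/
theorem measurePreserving_sphereMap (L : RSpace n ≃ₗᵢ[ℝ] RSpace n) :
    MeasurePreserving (sphereMap L) (surfaceMeasure n) (surfaceMeasure n) := by
  refine ⟨(continuous_sphereMap L).measurable, ?_⟩
  ext A hA
  have hA' := (continuous_sphereMap L).measurable hA
  rw [Measure.map_apply (continuous_sphereMap L).measurable hA, surfaceMeasure,
    Measure.toSphere_apply' _ hA', Measure.toSphere_apply' _ hA]
  congr 1
  have h1 : Ioo (0 : ℝ) 1 • ((↑) '' (sphereMap L ⁻¹' A) : Set (RSpace n)) =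
      L ⁻¹' (Ioo (0 : ℝ) 1 • ((↑) '' A : Set (RSpace n))) := by
    ext x
    simp only [Set.mem_smul, mem_preimage, mem_image]
    constructor
    · rintro ⟨t, ht, _, ⟨ξ, hξ, rfl⟩, rfl⟩
      exact ⟨t, ht, _, ⟨_, hξ, rfl⟩, by simp [sphereMap]⟩
    · rintro ⟨t, ht, _, ⟨ξ, hξ, rfl⟩, h⟩
      refine ⟨t, ht, _, ⟨sphereMap L.symm ξ, ?_, rfl⟩, ?_⟩
      · have : sphereMap L (sphereMap L.symm ξ) = ξ := by ext; simp [sphereMap]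
        rwa [this]
      · apply L.injective
        simp only [sphereMap, map_smul, LinearIsometryEquiv.apply_symm_apply]
        exact h
  rw [h1]
  exact (LinearIsometryEquiv.measurePreserving L).measure_preimage_emb
    L.toHomeomorph.measurableEmbedding _

/-- The Poisson integral of the constant function `1`. -/
def poissonMass (n : ℕ) (s : ℝ) (x : RSpace n) : ℝ :=
  weightedIntegral (surfaceMeasure n) (fun _ => 1) (ballPoissonKernel s) x

theorem poissonMass_eq (s : ℝ) (x : RSpace n) :
    poissonMass n s x = ∫ ξ : UnitSphere n, ballPoissonKernel s (x, ↑ξ) ∂(surfaceMeasure n) := by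
  simp [poissonMass, weightedIntegral]

/-- The reflection in the hyperplane orthogonal to `x - y` sends `x` to `y` and preserves both the
kernel and the surface measure. -/
theorem poissonMass_eq_of_norm_eq (s : ℝ) {x y : RSpace n} (h : ‖x‖ = ‖y‖) :
    poissonMass n s x = poissonMass n s y := by
  set L : RSpace n ≃ₗᵢ[ℝ] RSpace n := (Submodule.span ℝ {x - y})ᗮ.reflection
  have hL : L x = y := Submodule.reflection_sub h
  have hemb : MeasurableEmbedding (sphereMap L) := by
    have hinj : Function.Injective (sphereMap L) := fun ξ η hξη =>
      Subtype.ext (L.injective (congrArg Subtype.val hξη))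
    exact ((continuous_sphereMap L).isClosedEmbedding hinj).measurableEmbedding
  rw [poissonMass_eq, poissonMass_eq, ← (measurePreserving_sphereMap L).integral_comp hemb
    (fun ξ => ballPoissonKernel s (y, (ξ : RSpace n)))]
  refine integral_congr_ae (Eventually.of_forall fun ξ => ?_)
  simp only [ballPoissonKernel, sphereMap]
  rw [← hL, ← map_sub, L.norm_map, L.norm_map]

theorem integrable_ballPoissonKernel (s : ℝ) {f : UnitSphere n → ℝ} (hf : Continuous f)
    {x : RSpace n} (hx : x ∈ unitBall n) :
    Integrable (fun ξ : UnitSphere n => f ξ * ballPoissonKernel s (x, ↑ξ)) (surfaceMeasure n) :=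
  integrable_weightedIntegrand hf (contDiffOn_poissonKernel s).continuousOn mem_poissonDomain hx

theorem integrable_ballPoissonKernel' (s : ℝ) {x : RSpace n} (hx : x ∈ unitBall n) :
    Integrable (fun ξ : UnitSphere n => ballPoissonKernel s (x, ↑ξ)) (surfaceMeasure n) := by
  simpa using integrable_ballPoissonKernel s (f := fun _ => 1) continuous_const hx

theorem poissonMass_pos (s : ℝ) {x : RSpace n} (hx : x ∈ unitBall n) : 0 < poissonMass n s x := by
  have hpos : ∀ ξ : UnitSphere n, 0 < ballPoissonKernel s (x, (ξ : RSpace n)) := fun ξ =>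
    ballPoissonKernel_pos s (mem_poissonDomain x hx ξ)
  rw [poissonMass_eq, integral_pos_iff_support_of_nonneg (fun ξ => (hpos ξ).le)
    (integrable_ballPoissonKernel' s hx)]
  have : Function.support (fun ξ : UnitSphere n => ballPoissonKernel s (x, (ξ : RSpace n))) = univ :=
    eq_univ_of_forall fun ξ => (hpos ξ).ne'
  rw [this]
  exact isOpen_univ.measure_pos _ ⟨⟨EuclideanSpace.single 0 1, by simp⟩, mem_univ _⟩

theorem isBallSolution_poissonIntegral (s : ℝ) {f : UnitSphere n → ℝ} (hf : Continuous f) :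
    IsBallSolution s (weightedIntegral (surfaceMeasure n) f (ballPoissonKernel s)) :=
  ⟨contDiffOn_poissonIntegral s hf, fun _ hx => hyperbolicLaplacian_weightedIntegral s hf hx⟩

theorem isBallSolution_poissonMass (s : ℝ) : IsBallSolution s (poissonMass n s) :=
  isBallSolution_poissonIntegral s continuous_const

/-! ### The radial solution -/

/-- The radial solution `(1 - |x|²)^{n/2-γ} F_0(|x|²)`. -/
def radialSolution (n : ℕ) (γ : ℝ) (x : RSpace n) : ℝ :=
  (1 - ‖x‖ ^ 2) ^ ((n : ℝ) / 2 - γ) * radialHypergeometric n γ 0 (‖x‖ ^ 2)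

theorem isBallSolution_radialSolution {γ : ℝ} (hγ : 0 < γ) :
    IsBallSolution (n / 2 + γ) (radialSolution n γ) := by
  have := isBallSolution_ballMode (n := n) hγ (MvPolynomial.isHomogeneous_one _ ℝ) (by simp)
  have e : ballMode n γ 0 1 = radialSolution n γ := by
    funext x
    simp [ballMode, radialSolution, polyFun]
  rwa [e] at this

theorem radialSolution_zero (γ : ℝ) : radialSolution n γ 0 = 1 := by
  simp [radialSolution, radialHypergeometric_zero]

theorem radialSolution_eq_of_norm_eq (γ : ℝ) {x y : RSpace n} (h : ‖x‖ = ‖y‖) :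
    radialSolution n γ x = radialSolution n γ y := by
  rw [radialSolution, radialSolution, h]

theorem poissonMass_zero (s : ℝ) :
    poissonMass n s 0 = (surfaceMeasure n).real univ := by
  simp [poissonMass_eq, ballPoissonKernel]

/-- Let `P` be the Poisson integral of `1` and `V` the radial solution. The solution `y ↦ P(x) V(y)
- V(x) P(y)` vanishes on the sphere `|y| = |x|`, hence at the origin, where `V = 1` and `P` is the
total area. No uniqueness theorem for the radial differential equation is needed. The supersolution
is built from `P`, which is visibly positive. -/
theorem poissonMass_eq_radialSolution {γ : ℝ} (hγ : 0 < γ) {x : RSpace n} (hx : x ∈ unitBall n) :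
    poissonMass n (n / 2 + γ) x = (surfaceMeasure n).real univ * radialSolution n γ x := by
  have hP := isBallSolution_poissonMass (n := n) (n / 2 + γ)
  have hQ := hP.isBallSupersolution_add hγ.ne' fun y hy => poissonMass_pos _ hy
  have hv := ((isBallSolution_radialSolution (n := n) hγ).const_mul (poissonMass n (n / 2 + γ) x)).sub
    (hP.const_mul (radialSolution n γ x))
  have := hv.eq_zero_of_eq_zero_on_sphere hQ (mem_unitBall.1 hx) (fun y hy => by
    rw [poissonMass_eq_of_norm_eq _ hy, radialSolution_eq_of_norm_eq γ hy]
    ring) (x := 0) (by simp)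
  simp only [radialSolution_zero, poissonMass_zero] at this
  linarith

theorem surfaceMeasure_real_univ (n : ℕ) : (surfaceMeasure n).real univ =
    2 * Real.pi ^ (((n : ℝ) + 1) / 2) / Real.Gamma (((n : ℝ) + 1) / 2) := by
  rw [surfaceMeasure, Measure.toSphere_real_apply_univ, measureReal_def,
    EuclideanSpace.volume_ball]
  have h1 : ((n : ℝ) + 1) / 2 ≠ 0 := by positivity
  have h2 := Real.Gamma_pos_of_pos (by positivity : 0 < ((n : ℝ) + 1) / 2)
  simp only [finrank_euclideanSpace, Fintype.card_fin, ENNReal.ofReal_one, one_pow, one_mul]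
  push_cast
  rw [Real.Gamma_add_one h1, ENNReal.toReal_ofReal (by positivity), Real.sqrt_eq_rpow,
    ← Real.rpow_natCast, ← Real.rpow_mul Real.pi_pos.le]
  push_cast
  rw [show 1 / 2 * ((n : ℝ) + 1) = (n + 1) / 2 by ring]
  field_simp

theorem surfaceMeasure_real_univ_pos (n : ℕ) : 0 < (surfaceMeasure n).real univ := by
  have h2 := Real.Gamma_pos_of_pos (by positivity : 0 < ((n : ℝ) + 1) / 2)
  rw [surfaceMeasure_real_univ]
  positivity

/-- The hypergeometric series may have negative terms, so positivity is read off from the Poisson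
integral instead. -/
theorem radialSolution_pos {γ : ℝ} (hγ : 0 < γ) {x : RSpace n} (hx : x ∈ unitBall n) :
    0 < radialSolution n γ x := by
  have h := poissonMass_pos (n / 2 + γ) hx
  rw [poissonMass_eq_radialSolution hγ hx] at h
  exact pos_of_mul_pos_right h (surfaceMeasure_real_univ_pos n).le

/-- The normalizing constant of the Poisson kernel. -/
def poissonConst (n : ℕ) (γ : ℝ) : ℝ := Real.pi ^ (-((n : ℝ) / 2)) *
  ((2 : ℝ) ^ (-((n : ℝ) / 2 + γ)) * Real.Gamma ((n : ℝ) / 2 + γ) / Real.Gamma γ)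

theorem poissonConst_pos {γ : ℝ} (hγ : 0 < γ) : 0 < poissonConst n γ := by
  have h1 := Real.Gamma_pos_of_pos hγ
  have h2 := Real.Gamma_pos_of_pos (by positivity : 0 < (n : ℝ) / 2 + γ)
  rw [poissonConst]
  positivity

/-- This says that the normalized Poisson integral of `1` has boundary value `1`. After inserting
the area of the sphere and Gauss' value of `F_0(1)`, it is the duplication formula for Gamma at `γ`.
-/
theorem poissonConst_normalization {γ : ℝ} (hγ : 0 < γ) :
    poissonConst n γ * (surfaceMeasure n).real univ * 2 ^ ((n : ℝ) / 2 - γ) *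
      radialHypergeometric n γ 0 1 = 1 := by
  have h1 := Real.Gamma_pos_of_pos hγ
  have h2 := Real.Gamma_pos_of_pos (by positivity : 0 < (n : ℝ) / 2 + γ)
  have h3 := Real.Gamma_pos_of_pos (by positivity : 0 < ((n : ℝ) + 1) / 2)
  have h4 := Real.Gamma_pos_of_pos (by positivity : 0 < γ + 1 / 2)
  have hdup := Real.Gamma_mul_Gamma_add_half γ
  rw [poissonConst, surfaceMeasure_real_univ, radialHypergeometric_one hγ]
  simp only [Nat.cast_zero, zero_add]
  rw [add_comm γ ((n : ℝ) / 2)]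
  have e1 : Real.pi ^ (-((n : ℝ) / 2)) * Real.pi ^ (((n : ℝ) + 1) / 2) = √Real.pi := by
    rw [← Real.rpow_add Real.pi_pos, Real.sqrt_eq_rpow]
    ring_nf
  have e2 : (2 : ℝ) ^ (-((n : ℝ) / 2 + γ)) * 2 ^ ((n : ℝ) / 2 - γ) * 2 = 2 ^ (1 - 2 * γ) := by
    rw [← Real.rpow_add two_pos, ← Real.rpow_add_one two_ne_zero]
    ring_nf
  generalize Real.Gamma (γ + 1 / 2) = g1 at *
  generalize Real.Gamma ((n : ℝ) / 2 + γ) = g2 at *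
  generalize Real.Gamma (((n : ℝ) + 1) / 2) = g3 at *
  generalize (2 : ℝ) ^ (-((n : ℝ) / 2 + γ)) = p1 at *
  generalize (2 : ℝ) ^ ((n : ℝ) / 2 - γ) = p2 at *
  generalize Real.pi ^ (-((n : ℝ) / 2)) = p3 at *
  generalize Real.pi ^ (((n : ℝ) + 1) / 2) = p4 at *
  field_simp
  rw [hdup, ← e1, ← e2]
  ring

/-! ### Uniqueness -/

theorem flatDefining_smul {r : ℝ} (ξ : UnitSphere n) :
    flatDefining (r • (ξ : RSpace n)) = (1 - r ^ 2) / 2 := by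
  rw [flatDefining, norm_smul, norm_eq_of_mem_sphere ξ, mul_one, Real.norm_eq_abs, sq_abs]

theorem norm_smul_sphere_sq {r : ℝ} (ξ : UnitSphere n) : ‖r • (ξ : RSpace n)‖ ^ 2 = r ^ 2 := by
  rw [norm_smul, norm_eq_of_mem_sphere ξ, mul_one, Real.norm_eq_abs, sq_abs]

theorem smul_mem_unitBall {r : ℝ} (h0 : 0 ≤ r) (h1 : r < 1) (ξ : UnitSphere n) :
    r • (ξ : RSpace n) ∈ unitBall n := by
  rwa [mem_unitBall, norm_smul, norm_eq_of_mem_sphere ξ, mul_one, Real.norm_eq_abs,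
    abs_of_nonneg h0]

theorem exists_eq_smul_sphere {R : ℝ} (hR : 0 < R) {x : RSpace n} (hx : ‖x‖ = R) :
    ∃ ξ : UnitSphere n, x = R • (ξ : RSpace n) := by
  refine ⟨⟨R⁻¹ • x, ?_⟩, ?_⟩
  · rw [mem_sphere_zero_iff_norm, norm_smul, hx, Real.norm_eq_abs, abs_of_pos (by positivity)]
    field_simp
  · simp only
    rw [smul_smul, mul_inv_cancel₀ hR.ne', one_smul]

theorem one_sub_sq_pos {r : ℝ} (h0 : 0 ≤ r) (h1 : r < 1) : 0 < 1 - r ^ 2 := by nlinarith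

theorem flatDefining_rpow_mul_radial {γ : ℝ} {r : ℝ} (h0 : 0 ≤ r) (h1 : r < 1) :
    ((1 - r ^ 2) / 2) ^ ((n : ℝ) / 2 + γ - n) * (1 - r ^ 2) ^ ((n : ℝ) / 2 - γ) =
      2 ^ ((n : ℝ) / 2 - γ) := by
  have h := one_sub_sq_pos h0 h1
  rw [Real.div_rpow h.le two_pos.le, show (n : ℝ) / 2 + γ - n = -((n : ℝ) / 2 - γ) by ring,
    Real.rpow_neg h.le, Real.rpow_neg two_pos.le]
  have := Real.rpow_pos_of_pos h ((n : ℝ) / 2 - γ)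
  field_simp

theorem flatDefining_rpow_mul_radialSolution (γ : ℝ) {r : ℝ} (h0 : 0 ≤ r) (h1 : r < 1)
    (ξ : UnitSphere n) :
    flatDefining (r • (ξ : RSpace n)) ^ ((n : ℝ) / 2 + γ - n) * radialSolution n γ (r • ↑ξ) =
      2 ^ ((n : ℝ) / 2 - γ) * radialHypergeometric n γ 0 (r ^ 2) := by
  rw [flatDefining_smul, radialSolution, norm_smul_sphere_sq, ← mul_assoc,
    flatDefining_rpow_mul_radial h0 h1]

theorem tendsto_radialHypergeometric_sq {γ : ℝ} (hγ : 0 < γ) (n l : ℕ) :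
    Tendsto (fun r : ℝ => radialHypergeometric n γ l (r ^ 2)) (𝓝[<] 1)
      (𝓝 (radialHypergeometric n γ l 1)) := by
  have h := continuousOn_radialHypergeometric hγ n l 1 (right_mem_Icc.2 zero_le_one)
  refine h.tendsto.comp (tendsto_nhdsWithin_iff.2 ⟨?_, ?_⟩)
  · have : Tendsto (fun r : ℝ => r ^ 2) (𝓝 1) (𝓝 (1 ^ 2)) := (continuous_pow 2).tendsto 1
    rw [one_pow] at this
    exact this.mono_left nhdsWithin_le_nhds
  · filter_upwards [Ioo_mem_nhdsLT (zero_lt_one' ℝ)] with r hr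
    exact ⟨by positivity, by nlinarith [hr.1, hr.2]⟩

/-- Near the boundary `ρ₀^{s-n} Q` is bounded below by a positive `κ`, so the hypothesis with `ε = M
κ` gives `w ≤ M Q` on a sphere enclosing `x`. Comparison carries this inside, and `M` is arbitrary.
-/
theorem IsBallSolution.le_zero_of_boundary {γ : ℝ} (hγ : 0 < γ) {w : RSpace n → ℝ}
    (hw : IsBallSolution (n / 2 + γ) w)
    (hb : ∀ ε > 0, ∀ᶠ r in 𝓝[<] (1 : ℝ), ∀ ξ : UnitSphere n,
      flatDefining (r • (ξ : RSpace n)) ^ ((n : ℝ) / 2 + γ - n) * w (r • ↑ξ) ≤ ε)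
    {x : RSpace n} (hx : x ∈ unitBall n) : w x ≤ 0 := by
  have hV := isBallSolution_radialSolution (n := n) hγ
  have hQ := hV.isBallSupersolution_add hγ.ne' fun y hy => radialSolution_pos hγ hy
  set Q : RSpace n → ℝ := fun x => radialSolution n γ x + (1 - ‖x‖ ^ 2) ^ ((n : ℝ) / 2) with hQdef
  have hF := radialHypergeometric_one_pos hγ n 0
  -- Half the boundary limit of `ρ₀^{s-n}` times the radial solution.
  set κ : ℝ := 2 ^ ((n : ℝ) / 2 - γ) * (radialHypergeometric n γ 0 1 / 2) with hκ
  have hκ0 : 0 < κ := by positivity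
  have key : ∀ M > 0, w x ≤ M * Q x := by
    intro M hM
    have hlim := (tendsto_radialHypergeometric_sq hγ n 0).eventually (lt_mem_nhds (half_lt_self hF))
    obtain ⟨R, ⟨hR1, hR2⟩, hR3, hR4⟩ := (((hb (M * κ) (by positivity)).and hlim).and
      (Ioo_mem_nhdsLT (max_lt (mem_unitBall.1 hx) (zero_lt_one' ℝ)))).exists
    have hR0 : 0 < R := (le_max_right _ _).trans_lt hR3
    refine hw.le_of_le_on_sphere hQ hM.le hR4 (fun y hy => ?_) ((le_max_left _ _).trans hR3.le)
    obtain ⟨ξ, rfl⟩ := exists_eq_smul_sphere hR0 hy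
    have hmem := smul_mem_unitBall hR0.le hR4 ξ
    have h1 := hR1 ξ
    have h2 := flatDefining_rpow_mul_radialSolution γ hR0.le hR4 ξ
    have hρ := Real.rpow_pos_of_pos (flatDefining_pos hmem) ((n : ℝ) / 2 + γ - n)
    have h3 : κ ≤ flatDefining (R • (ξ : RSpace n)) ^ ((n : ℝ) / 2 + γ - n) *
        radialSolution n γ (R • ↑ξ) := by
      rw [h2, hκ]
      gcongr
    have h4 : w (R • ↑ξ) ≤ M * radialSolution n γ (R • ↑ξ) := by
      refine le_of_mul_le_mul_left ?_ hρ
      calc _ ≤ M * κ := h1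
        _ ≤ M * _ := mul_le_mul_of_nonneg_left h3 hM.le
        _ = _ := by ring
    refine h4.trans (mul_le_mul_of_nonneg_left ?_ hM.le)
    have h5 := one_sub_norm_sq_pos (mem_unitBall.1 hmem)
    have := Real.rpow_pos_of_pos h5 ((n : ℝ) / 2)
    simp only [hQdef]
    linarith
  have hlim : Tendsto (fun M : ℝ => M * Q x) (𝓝[>] 0) (𝓝 (0 * Q x)) :=
    ((continuous_id.mul continuous_const).tendsto 0).mono_left nhdsWithin_le_nhds
  rw [zero_mul] at hlim
  exact ge_of_tendsto hlim (by filter_upwards [self_mem_nhdsWithin] with M hM using key M hM)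

theorem IsPoissonSolution.isBallSolution {s : ℝ} {f : UnitSphere n → ℝ} {u : RSpace n → ℝ}
    (hu : IsPoissonSolution n s f u) : IsBallSolution s u :=
  isBallSolution_iff.2 ⟨hu.contDiffOn, hu.equation⟩

theorem IsPoissonSolution.le {γ : ℝ} (hγ : 0 < γ) {f : UnitSphere n → ℝ} {u v : RSpace n → ℝ}
    (hu : IsPoissonSolution n (n / 2 + γ) f u) (hv : IsPoissonSolution n (n / 2 + γ) f v)
    {x : RSpace n} (hx : x ∈ unitBall n) : u x ≤ v x := by
  refine sub_nonpos.1 ((hu.isBallSolution.sub hv.isBallSolution).le_zero_of_boundary hγ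
    (fun ε hε => ?_) hx)
  filter_upwards [Metric.tendstoUniformly_iff.1 hu.boundary (ε / 2) (half_pos hε),
    Metric.tendstoUniformly_iff.1 hv.boundary (ε / 2) (half_pos hε)] with r h1 h2 ξ
  have h1 := abs_lt.1 (h1 ξ)
  have h2 := abs_lt.1 (h2 ξ)
  rw [mul_sub]
  linarith [h1.1, h1.2, h2.1, h2.2]

theorem IsPoissonSolution.eqOn {γ : ℝ} (hγ : 0 < γ) {f : UnitSphere n → ℝ} {u v : RSpace n → ℝ}
    (hu : IsPoissonSolution n (n / 2 + γ) f u) (hv : IsPoissonSolution n (n / 2 + γ) f v) :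
    EqOn u v (unitBall n) := fun _ hx => le_antisymm (hu.le hγ hv hx) (hv.le hγ hu hx)
end

noncomputable section

variable {n : ℕ}

/-! ### Boundary values of Poisson integrals -/

/-- The normalized Poisson integral of `f`. -/
def poissonSolution (n : ℕ) (γ : ℝ) (f : UnitSphere n → ℝ) (x : RSpace n) : ℝ :=
  poissonConst n γ * weightedIntegral (surfaceMeasure n) f (ballPoissonKernel (n / 2 + γ)) x

/-- The boundary factor of the Poisson integral of `1`. -/
theorem poissonConst_mul_flatDefining_rpow_mul_poissonMass {γ : ℝ} (hγ : 0 < γ) {r : ℝ}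
    (h0 : 0 ≤ r) (h1 : r < 1) (ξ : UnitSphere n) :
    poissonConst n γ * (flatDefining (r • (ξ : RSpace n)) ^ ((n : ℝ) / 2 + γ - n) *
      poissonMass n (n / 2 + γ) (r • ↑ξ)) =
      radialHypergeometric n γ 0 (r ^ 2) / radialHypergeometric n γ 0 1 := by
  have h := flatDefining_rpow_mul_radialSolution γ h0 h1 ξ
  have hF := radialHypergeometric_one_pos hγ n 0
  rw [poissonMass_eq_radialSolution hγ (smul_mem_unitBall h0 h1 ξ), eq_div_iff hF.ne']
  linear_combination poissonConst n γ * (surfaceMeasure n).real univ *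
    radialHypergeometric n γ 0 1 * h + radialHypergeometric n γ 0 (r ^ 2) *
    poissonConst_normalization (n := n) hγ

/-- Moving `ξ` to `rξ` costs at most `δ/2`, so the denominator is at least `(δ/2)²`; the factor
`8/δ²` is `2/(δ/2)²`, from `1 - r² = 2ρ₀`. -/
theorem ballPoissonKernel_le_of_le_dist {s δ r : ℝ} (hs : 0 ≤ s) (hδ : 0 < δ) (h0 : 0 ≤ r)
    (h1 : r < 1) (hr : 1 - r ≤ δ / 2) {ξ η : UnitSphere n} (h : δ ≤ dist η ξ) :
    ballPoissonKernel s (r • (ξ : RSpace n), (η : RSpace n)) ≤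
      (flatDefining (r • (ξ : RSpace n)) * (8 / δ ^ 2)) ^ s := by
  have hd : δ / 2 ≤ ‖r • (ξ : RSpace n) - η‖ := by
    have h2 : dist η ξ = ‖(ξ : RSpace n) - η‖ := by
      rw [Subtype.dist_eq, dist_eq_norm, norm_sub_rev]
    have h3 : ‖(ξ : RSpace n) - r • (ξ : RSpace n)‖ = 1 - r := by
      rw [show (ξ : RSpace n) - r • (ξ : RSpace n) = (1 - r) • (ξ : RSpace n) by module,
        norm_smul, norm_eq_of_mem_sphere ξ, mul_one, Real.norm_eq_abs, abs_of_pos (by linarith)]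
    have h4 := norm_sub_le_norm_sub_add_norm_sub (ξ : RSpace n) (r • (ξ : RSpace n)) η
    linarith
  have hpos := one_sub_sq_pos h0 h1
  simp only [ballPoissonKernel]
  rw [norm_smul_sphere_sq, flatDefining_smul]
  refine Real.rpow_le_rpow (by positivity) ?_ hs
  calc (1 - r ^ 2) / ‖r • (ξ : RSpace n) - η‖ ^ 2 ≤ (1 - r ^ 2) / (δ / 2) ^ 2 := by gcongr
    _ = (1 - r ^ 2) / 2 * (8 / δ ^ 2) := by
      field_simp
      norm_num

/-- Approximate identity argument. Near `ξ` the oscillation of `f` is small and the mass of the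
kernel tends to `1`; away from `ξ` the kernel is `O(ρ₀^s)`, which after rescaling is `O(ρ₀^{2γ})`.
Uniform continuity of `f` makes the estimate uniform in `ξ`. -/
theorem isPoissonSolution_poissonSolution {γ : ℝ} (hγ : 0 < γ) (f : C(UnitSphere n, ℝ)) :
    IsPoissonSolution n (n / 2 + γ) f (poissonSolution n γ f) := by
  set s : ℝ := (n : ℝ) / 2 + γ with hs
  have hs0 : 0 < s := by positivity
  obtain ⟨h2, h3⟩ := isBallSolution_iff.1
    ((isBallSolution_poissonIntegral s f.continuous).const_mul (poissonConst n γ))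
  refine ⟨h2, h3, Metric.tendstoUniformly_iff.2 fun ε hε => ?_⟩
  have hc := poissonConst_pos (n := n) hγ
  have hS := surfaceMeasure_real_univ_pos n
  obtain ⟨δ, hδ, hfδ⟩ := Metric.uniformContinuous_iff.1
    (CompactSpace.uniformContinuous_of_continuous f.continuous) (ε / 4) (by positivity)
  have hM : ∀ ξ, |f ξ| ≤ ‖f‖ := fun ξ => f.norm_coe_le_norm ξ
  set m : ℝ → ℝ := fun r => radialHypergeometric n γ 0 (r ^ 2) / radialHypergeometric n γ 0 1
  set C : ℝ := poissonConst n γ * (2 * ‖f‖ * (8 / δ ^ 2) ^ s * (surfaceMeasure n).real univ)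
  -- The three terms are the near part, the far part and the defect of the mass `m r` from `1`;
  -- their sum tends to `ε / 4` and does not depend on `ξ`.
  set B : ℝ → ℝ := fun r => ε / 4 * m r + C * ((1 - r ^ 2) / 2) ^ (2 * γ) + ‖f‖ * |m r - 1|
  have hm : Tendsto m (𝓝[<] 1) (𝓝 1) := by
    have := (tendsto_radialHypergeometric_sq hγ n 0).div_const (radialHypergeometric n γ 0 1)
    rwa [div_self (radialHypergeometric_one_pos hγ n 0).ne'] at this
  have hB : Tendsto B (𝓝[<] 1) (𝓝 (ε / 4 * 1 + C * 0 + ‖f‖ * |1 - 1|)) := by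
    refine ((hm.const_mul _).add (Tendsto.const_mul C ?_)).add ((hm.sub_const 1).abs.const_mul _)
    have h1 : Continuous fun r : ℝ => ((1 - r ^ 2) / 2) ^ (2 * γ) :=
      Continuous.rpow_const (by fun_prop) fun _ => Or.inr (by positivity)
    have := h1.tendsto 1
    simp only [one_pow, sub_self, zero_div] at this
    rw [Real.zero_rpow (by positivity)] at this
    exact this.mono_left nhdsWithin_le_nhds
  have hBε : ∀ᶠ r in 𝓝[<] (1 : ℝ), B r < ε :=
    hB.eventually (gt_mem_nhds (by simp; linarith))
  filter_upwards [hBε, Ioo_mem_nhdsLT (zero_lt_one' ℝ),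
    Ioo_mem_nhdsLT (by linarith : 1 - δ / 2 < (1 : ℝ))] with r hr1 hr2 hr3 ξ
  have hx := smul_mem_unitBall hr2.1.le hr2.2 ξ
  set x : RSpace n := r • (ξ : RSpace n) with hxdef
  have hρ := flatDefining_pos hx
  set ρ := flatDefining x with hρdef
  have hρs : 0 < ρ ^ (s - n) := Real.rpow_pos_of_pos hρ _
  have hmass : poissonConst n γ * (ρ ^ (s - n) * poissonMass n s x) = m r :=
    poissonConst_mul_flatDefining_rpow_mul_poissonMass hγ hr2.1.le hr2.2 ξ
  have hkpos : ∀ η : UnitSphere n, 0 < ballPoissonKernel s (x, (η : RSpace n)) := fun η =>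
    ballPoissonKernel_pos s (mem_poissonDomain x hx η)
  have hik := integrable_ballPoissonKernel' s hx
  have hif := integrable_ballPoissonKernel s f.continuous hx
  have hdiff : weightedIntegral (surfaceMeasure n) f (ballPoissonKernel s) x -
      f ξ * poissonMass n s x =
      ∫ η : UnitSphere n, (f η - f ξ) * ballPoissonKernel s (x, ↑η) ∂(surfaceMeasure n) := by
    rw [poissonMass_eq, ← integral_const_mul, weightedIntegral]
    simp only [smul_eq_mul]
    rw [← integral_sub hif (hik.const_mul _)]
    simp only [sub_mul]
  have hbound : |∫ η : UnitSphere n, (f η - f ξ) * ballPoissonKernel s (x, ↑η)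
      ∂(surfaceMeasure n)| ≤ ε / 4 * poissonMass n s x +
      2 * ‖f‖ * (ρ * (8 / δ ^ 2)) ^ s * (surfaceMeasure n).real univ := by
    have hint2 : Integrable (fun η : UnitSphere n => ε / 4 * ballPoissonKernel s (x, ↑η) +
        2 * ‖f‖ * (ρ * (8 / δ ^ 2)) ^ s) (surfaceMeasure n) :=
      (hik.const_mul _).add (integrable_const _)
    have e : ε / 4 * poissonMass n s x +
        2 * ‖f‖ * (ρ * (8 / δ ^ 2)) ^ s * (surfaceMeasure n).real univ =
        ∫ η : UnitSphere n, (ε / 4 * ballPoissonKernel s (x, ↑η) +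
        2 * ‖f‖ * (ρ * (8 / δ ^ 2)) ^ s) ∂(surfaceMeasure n) := by
      rw [integral_add (hik.const_mul _) (integrable_const _), integral_const_mul, ← poissonMass_eq,
        integral_const, smul_eq_mul, mul_comm ((surfaceMeasure n).real univ)]
    rw [e, ← Real.norm_eq_abs]
    refine norm_integral_le_of_norm_le hint2 (Eventually.of_forall fun η => ?_)
    have hk := hkpos η
    rw [Real.norm_eq_abs, abs_mul, abs_of_pos hk]
    have hp : 0 ≤ (ρ * (8 / δ ^ 2)) ^ s := by positivity
    have hf2 : |f η - f ξ| ≤ 2 * ‖f‖ := by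
      refine (abs_sub _ _).trans ?_
      linarith [hM η, hM ξ]
    rcases lt_or_ge (dist η ξ) δ with h | h
    · have h4 : |f η - f ξ| ≤ ε / 4 := by
        have := hfδ h
        rw [Real.dist_eq] at this
        exact this.le
      have := mul_le_mul_of_nonneg_right h4 hk.le
      have : 0 ≤ 2 * ‖f‖ * (ρ * (8 / δ ^ 2)) ^ s := by positivity
      linarith
    · have h5 := ballPoissonKernel_le_of_le_dist hs0.le hδ hr2.1.le hr2.2
        (by linarith [hr3.1] : 1 - r ≤ δ / 2) h
      have := mul_le_mul hf2 h5 hk.le (by positivity)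
      have : 0 ≤ ε / 4 * ballPoissonKernel s (x, ↑η) := by positivity
      linarith
  have hpow : ρ ^ (s - n) * (ρ * (8 / δ ^ 2)) ^ s = (8 / δ ^ 2) ^ s * ρ ^ (2 * γ) := by
    rw [Real.mul_rpow hρ.le (by positivity), ← mul_assoc, ← Real.rpow_add hρ, mul_comm]
    congr 2
    rw [hs]
    ring
  have hρr : ρ = (1 - r ^ 2) / 2 := flatDefining_smul ξ
  rw [dist_comm, Real.dist_eq]
  refine lt_of_le_of_lt ?_ hr1
  have hsplit : ρ ^ (s - n) * poissonSolution n γ f x - f ξ =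
      poissonConst n γ * ρ ^ (s - n) * (∫ η : UnitSphere n,
        (f η - f ξ) * ballPoissonKernel s (x, ↑η) ∂(surfaceMeasure n)) + f ξ * (m r - 1) := by
    rw [← hdiff, ← hmass, poissonSolution]
    ring
  rw [hsplit]
  refine (abs_add_le _ _).trans (add_le_add ?_ ?_)
  · rw [abs_mul, abs_of_pos (by positivity)]
    refine (mul_le_mul_of_nonneg_left hbound (by positivity)).trans (le_of_eq ?_)
    rw [← hρr, ← hmass]
    linear_combination poissonConst n γ * (2 * ‖f‖ * (surfaceMeasure n).real univ) * hpow
  · rw [abs_mul]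
    exact mul_le_mul_of_nonneg_right (hM ξ) (abs_nonneg _)

/-! ### Spherical harmonics -/

theorem IsSphericalHarmonic.continuous {l : ℕ} {Y : UnitSphere n → ℝ}
    (hY : IsSphericalHarmonic n l Y) : Continuous Y := by
  obtain ⟨p, -, -, hp⟩ := hY
  rw [show Y = fun ξ : UnitSphere n => polyFun p (ξ : RSpace n) from funext hp]
  exact (contDiff_polyFun p).continuous.comp continuous_subtype_val

/-- The Poisson integral of a spherical harmonic. -/
theorem poissonSolution_sphericalHarmonic {γ : ℝ} (hγ : 0 < γ) {l : ℕ} {Y : UnitSphere n → ℝ}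
    (hY : IsSphericalHarmonic n l Y) {r : ℝ} (h0 : 0 ≤ r) (h1 : r < 1) (ξ : UnitSphere n) :
    poissonSolution n γ Y (r • (ξ : RSpace n)) =
      flatDefining (r • (ξ : RSpace n)) ^ ((n : ℝ) / 2 - γ) *
        (radialProfile n γ l (r ^ 2) * r ^ l * Y ξ) := by
  have hYc := hY.continuous
  obtain ⟨p, hp, hΔ, hpY⟩ := hY
  have hF := radialHypergeometric_one_pos hγ n l
  -- The reciprocal of the factor multiplying `Y` in the boundary limit of the separated solution;
  -- the power of `2` comes from `1 - |x|² = 2ρ₀`.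
  set c : ℝ := (2 ^ ((n : ℝ) / 2 - γ) * radialHypergeometric n γ l 1)⁻¹
  have hmode : ∀ {r : ℝ}, ∀ ξ : UnitSphere n, ballMode n γ l p (r • (ξ : RSpace n)) =
      (1 - r ^ 2) ^ ((n : ℝ) / 2 - γ) * radialHypergeometric n γ l (r ^ 2) * (r ^ l * Y ξ) := by
    intro r ξ
    rw [ballMode, norm_smul_sphere_sq, polyFun_smul hp, hpY ξ]
    rfl
  have hU : IsPoissonSolution n (n / 2 + γ) Y (fun x => c * ballMode n γ l p x) := by
    obtain ⟨h2, h3⟩ := isBallSolution_iff.1 ((isBallSolution_ballMode hγ hp hΔ).const_mul c)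
    refine ⟨h2, h3, Metric.tendstoUniformly_iff.2 fun ε hε => ?_⟩
    obtain ⟨M, hM⟩ := isCompact_univ.exists_bound_of_continuousOn hYc.continuousOn
    set m : ℝ → ℝ := fun r => radialHypergeometric n γ l (r ^ 2) / radialHypergeometric n γ l 1 *
      r ^ l
    have hm : Tendsto m (𝓝[<] 1) (𝓝 1) := by
      have e1 := (tendsto_radialHypergeometric_sq hγ n l).div_const (radialHypergeometric n γ l 1)
      have e2 : Tendsto (fun r : ℝ => r ^ l) (𝓝[<] 1) (𝓝 (1 ^ l)) :=
        ((continuous_pow l).tendsto 1).mono_left nhdsWithin_le_nhds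
      have := e1.mul e2
      rwa [div_self hF.ne', one_pow, one_mul] at this
    have hlim : Tendsto (fun r => M * |m r - 1|) (𝓝[<] 1) (𝓝 (M * |1 - 1|)) :=
      (hm.sub_const 1).abs.const_mul M
    rw [sub_self, abs_zero, mul_zero] at hlim
    filter_upwards [hlim.eventually (gt_mem_nhds hε), Ioo_mem_nhdsLT (zero_lt_one' ℝ)]
      with r hr hr2 ξ
    have hrad := flatDefining_rpow_mul_radial (n := n) (γ := γ) hr2.1.le hr2.2
    have e : flatDefining (r • (ξ : RSpace n)) ^ ((n : ℝ) / 2 + γ - n) *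
        (c * ballMode n γ l p (r • (ξ : RSpace n))) = m r * Y ξ := by
      rw [hmode, flatDefining_smul]
      simp only [m, c]
      have h2 : (0 : ℝ) < 2 ^ ((n : ℝ) / 2 - γ) := by positivity
      rw [← hrad] at h2 ⊢
      have h3 := left_ne_zero_of_mul h2.ne'
      have h4 := right_ne_zero_of_mul h2.ne'
      generalize ((1 - r ^ 2) / 2) ^ ((n : ℝ) / 2 + γ - n) = A at *
      generalize (1 - r ^ 2) ^ ((n : ℝ) / 2 - γ) = B at *
      field_simp
    rw [e, dist_comm, Real.dist_eq, show m r * Y ξ - Y ξ = Y ξ * (m r - 1) by ring, abs_mul]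
    exact (mul_le_mul_of_nonneg_right (hM ξ (mem_univ ξ)) (abs_nonneg _)).trans_lt hr
  have heq : poissonSolution n γ Y (r • (ξ : RSpace n)) = c * ballMode n γ l p (r • (ξ : RSpace n)) :=
    (isPoissonSolution_poissonSolution hγ ⟨Y, hYc⟩).eqOn hγ hU (smul_mem_unitBall h0 h1 ξ)
  rw [heq, hmode,
    flatDefining_smul, radialProfile, Real.div_rpow (one_sub_sq_pos h0 h1).le two_pos.le]
  simp only [c]
  have h2 : (2 : ℝ) ^ ((n : ℝ) / 2 - γ) ≠ 0 := by positivity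
  field_simp

/-! ### `L²` estimates -/

theorem abs_integral_mul_le_sqrt {f g : UnitSphere n → ℝ} (hf : Continuous f)
    (hg : Continuous g) : |∫ ξ, f ξ * g ξ ∂(surfaceMeasure n)| ≤
      √(∫ ξ, f ξ ^ 2 ∂(surfaceMeasure n)) * √(∫ ξ, g ξ ^ 2 ∂(surfaceMeasure n)) := by
  have hmem : ∀ {f : UnitSphere n → ℝ}, Continuous f → MemLp f (ENNReal.ofReal 2)
      (surfaceMeasure n) := fun {f} hf => by
    obtain ⟨C, hC⟩ := isCompact_univ.exists_bound_of_continuousOn hf.continuousOn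
    exact MemLp.of_bound hf.aestronglyMeasurable_of_compactSpace C
      (Eventually.of_forall fun ξ => hC ξ (mem_univ ξ))
  have h := integral_mul_norm_le_Lp_mul_Lq (p := 2) (q := 2) (f := f) (g := g)
    (by norm_num [Real.holderConjugate_iff]) (hmem hf) (hmem hg)
  rw [← Real.norm_eq_abs]
  refine (norm_integral_le_integral_norm _).trans ?_
  simp only [norm_mul]
  refine h.trans (le_of_eq ?_)
  simp [Real.sqrt_eq_rpow]

/-- For fixed interior `x` the kernel is continuous on the sphere, so Cauchy-Schwarz applies. This
turns `L²` convergence of boundary data into pointwise convergence of solutions. -/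
theorem abs_poissonSolution_le {γ : ℝ} (hγ : 0 < γ) {x : RSpace n} (hx : x ∈ unitBall n) :
    ∃ C : ℝ, 0 ≤ C ∧ ∀ f : UnitSphere n → ℝ, Continuous f →
      |poissonSolution n γ f x| ≤ C * √(∫ ξ, f ξ ^ 2 ∂(surfaceMeasure n)) := by
  have hk : Continuous fun ξ : UnitSphere n => ballPoissonKernel (n / 2 + γ) (x, (ξ : RSpace n)) :=
    (contDiffOn_poissonKernel _).continuousOn.continuous_comp_prodMk_subtype mem_poissonDomain hx
  have hc := poissonConst_pos (n := n) hγ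
  refine ⟨poissonConst n γ * √(∫ ξ : UnitSphere n, ballPoissonKernel (n / 2 + γ) (x, ↑ξ) ^ 2
    ∂(surfaceMeasure n)), by positivity, fun f hf => ?_⟩
  rw [poissonSolution, abs_mul, abs_of_pos hc, mul_assoc]
  refine mul_le_mul_of_nonneg_left ?_ hc.le
  rw [mul_comm]
  exact abs_integral_mul_le_sqrt hf hk

theorem poissonSolution_sub {γ : ℝ} {f g : UnitSphere n → ℝ} (hf : Continuous f)
    (hg : Continuous g) {x : RSpace n} (hx : x ∈ unitBall n) :
    poissonSolution n γ (fun ξ => f ξ - g ξ) x = poissonSolution n γ f x - poissonSolution n γ g x := by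
  simp only [poissonSolution, weightedIntegral, smul_eq_mul, sub_mul]
  rw [integral_sub (integrable_ballPoissonKernel _ hf hx) (integrable_ballPoissonKernel _ hg hx)]
  ring

theorem poissonSolution_finsetSum {γ : ℝ} {Y : ℕ → UnitSphere n → ℝ} (hY : ∀ l, Continuous (Y l))
    (s : Finset ℕ) {x : RSpace n} (hx : x ∈ unitBall n) :
    poissonSolution n γ (fun ξ => ∑ l ∈ s, Y l ξ) x = ∑ l ∈ s, poissonSolution n γ (Y l) x := by
  simp only [poissonSolution, weightedIntegral, smul_eq_mul, Finset.sum_mul, ← Finset.mul_sum]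
  rw [integral_finsetSum _ fun l _ => integrable_ballPoissonKernel _ (hY l) hx]

namespace IsHarmonicExpansion

variable {γ : ℝ} {f : UnitSphere n → ℝ} {Y : ℕ → UnitSphere n → ℝ}

theorem continuous (h : IsHarmonicExpansion n f Y) (l : ℕ) : Continuous (Y l) := (h.mem l).continuous

theorem tendsto_sum_poissonSolution (h : IsHarmonicExpansion n f Y) (hf : Continuous f)
    (hγ : 0 < γ) {x : RSpace n} (hx : x ∈ unitBall n) :
    Tendsto (fun N => ∑ l ∈ Finset.range N, poissonSolution n γ (Y l) x) atTop
      (𝓝 (poissonSolution n γ f x)) := by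
  obtain ⟨C, -, hC⟩ := abs_poissonSolution_le hγ hx
  have hs : ∀ N, Continuous fun ξ => ∑ l ∈ Finset.range N, Y l ξ := fun N =>
    continuous_finsetSum _ fun l _ => h.continuous l
  have hlim := ((Real.continuous_sqrt.tendsto _).comp h.tendsto).const_mul C
  simp only [Function.comp_def, Real.sqrt_zero, mul_zero] at hlim
  rw [tendsto_iff_norm_sub_tendsto_zero]
  refine squeeze_zero (fun _ => norm_nonneg _) (fun N => ?_) hlim
  rw [← poissonSolution_finsetSum h.continuous _ hx, norm_sub_rev, Real.norm_eq_abs,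
    ← poissonSolution_sub hf (hs N) hx]
  exact hC _ (hf.sub (hs N))

theorem exists_bound_poissonSolution (h : IsHarmonicExpansion n f Y) (hf : Continuous f)
    (hγ : 0 < γ) {x : RSpace n} (hx : x ∈ unitBall n) :
    ∃ C : ℝ, ∀ l, |poissonSolution n γ (Y l) x| ≤ C := by
  have hlim := h.tendsto_sum_poissonSolution hf hγ hx
  have h2 := ((tendsto_add_atTop_iff_nat 1).2 hlim).sub hlim
  -- The terms are differences of consecutive partial sums of a convergent sequence, so they tend to
  -- zero and are bounded.
  simp only [Finset.sum_range_succ_sub_sum] at h2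
  obtain ⟨C, hC⟩ := (Metric.isBounded_range_of_tendsto _ h2).exists_norm_le
  exact ⟨C, fun l => hC _ (mem_range_self l)⟩

/-- Convergence of the partial sums at a larger radius `q` bounds the terms there. Passing from `q`
to `r` costs a bounded ratio of radial factors and gains `(r/q)^l`, a geometric majorant. No
pointwise bound on `Y_l` itself is needed. -/
theorem summable_radialProfile (h : IsHarmonicExpansion n f Y) (hf : Continuous f)
    (hγ : 0 < γ) {r : ℝ} (h0 : 0 ≤ r) (h1 : r < 1) (ξ : UnitSphere n) :
    Summable fun l : ℕ => radialProfile n γ l (r ^ 2) * r ^ l * Y l ξ := by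
  obtain ⟨q, hrq, hq1⟩ := exists_between h1
  have hq0 : 0 < q := h0.trans_lt hrq
  have hx := smul_mem_unitBall hq0.le hq1 ξ
  have hρ : 0 < flatDefining (q • (ξ : RSpace n)) ^ ((n : ℝ) / 2 - γ) :=
    Real.rpow_pos_of_pos (flatDefining_pos hx) _
  set ρ := flatDefining (q • (ξ : RSpace n)) ^ ((n : ℝ) / 2 - γ)
  obtain ⟨C, hC⟩ := h.exists_bound_poissonSolution hf hγ hx
  obtain ⟨B, hB⟩ := exists_radialHypergeometric_ratio_bound hγ n (t := r ^ 2) (q := q ^ 2)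
    (by positivity) (by nlinarith) (by positivity) (by nlinarith)
  have hgeo : Summable fun l : ℕ => |B| * (C / ρ) * (r / q) ^ l :=
    (summable_geometric_of_lt_one (by positivity) ((div_lt_one hq0).2 hrq)).mul_left _
  refine Summable.of_norm_bounded_eventually_nat hgeo ?_
  filter_upwards [hB] with l hl
  have hF := radialHypergeometric_one_pos hγ n l
  have hCl := hC l
  rw [poissonSolution_sphericalHarmonic hγ (h.mem l) hq0.le hq1 ξ, abs_mul, abs_of_pos hρ] at hCl
  have hCl' : |radialProfile n γ l (q ^ 2) * q ^ l * Y l ξ| ≤ C / ρ := by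
    rwa [le_div_iff₀ hρ, mul_comm]
  have hl' : |radialProfile n γ l (r ^ 2)| ≤ |B| * |radialProfile n γ l (q ^ 2)| := by
    rw [radialProfile, radialProfile, abs_div, abs_div, mul_div_assoc', abs_of_pos hF]
    refine div_le_div_of_nonneg_right (hl.trans ?_) hF.le
    exact mul_le_mul_of_nonneg_right (le_abs_self B) (abs_nonneg _)
  rw [Real.norm_eq_abs]
  calc |radialProfile n γ l (r ^ 2) * r ^ l * Y l ξ|
      = |radialProfile n γ l (r ^ 2)| * r ^ l * |Y l ξ| := by
        rw [abs_mul, abs_mul, abs_of_nonneg (pow_nonneg h0 l)]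
    _ ≤ |B| * |radialProfile n γ l (q ^ 2)| * r ^ l * |Y l ξ| := by gcongr
    _ = |B| * |radialProfile n γ l (q ^ 2) * q ^ l * Y l ξ| * (r / q) ^ l := by
        rw [abs_mul, abs_mul, abs_of_nonneg (pow_nonneg hq0.le l), div_pow]
        field_simp
    _ ≤ |B| * (C / ρ) * (r / q) ^ l := by gcongr

end IsHarmonicExpansion
end

/-! ### The scattering theorem on the ball -/

theorem theorem4p1 (n : ℕ) (hn : 1 ≤ n) (γ : ℝ) (hγ : 0 < γ) (hγN : ∀ m : ℕ, γ ≠ (m : ℝ))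
    (s : ℝ) (hs : s = (n : ℝ) / 2 + γ) (f : C(UnitSphere n, ℝ)) :
    ∃ u : RSpace n → ℝ,
      IsPoissonSolution n s f u ∧
      (∀ v : RSpace n → ℝ, IsPoissonSolution n s f v → Set.EqOn v u (unitBall n)) ∧
      (∀ x ∈ unitBall n,
        u x = Real.pi ^ (-((n : ℝ) / 2)) *
          ((2 : ℝ) ^ (-s) * Real.Gamma ((n : ℝ) / 2 + γ) / Real.Gamma γ) *
          ∫ ξ : UnitSphere n, ((1 - ‖x‖ ^ 2) / ‖x - (ξ : RSpace n)‖ ^ 2) ^ s * f ξ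
            ∂(surfaceMeasure n)) ∧
      (∀ Y : ℕ → UnitSphere n → ℝ, IsHarmonicExpansion n f Y →
        ∀ r ∈ Set.Ico (0 : ℝ) 1, ∀ ξ : UnitSphere n,
          Summable (fun l : ℕ => radialProfile n γ l (r ^ 2) * r ^ l * Y l ξ) ∧
          u (r • (ξ : RSpace n)) =
            flatDefining (r • (ξ : RSpace n)) ^ ((n : ℝ) - s) *
              ∑' l : ℕ, radialProfile n γ l (r ^ 2) * r ^ l * Y l ξ) ∧
      (∀ l : ℕ, ∀ t ∈ Set.Icc (0 : ℝ) 1,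
        radialProfile n γ l t =
          Real.Gamma (γ + 1 / 2) / Real.Gamma (2 * γ) *
            (Real.Gamma ((l : ℝ) + γ + (n : ℝ) / 2) / Real.Gamma ((l : ℝ) + ((n : ℝ) + 1) / 2)) *
            radialHypergeometric n γ l t) := by
  subst hs
  have hsol := isPoissonSolution_poissonSolution hγ f
  refine ⟨poissonSolution n γ f, hsol, fun v hv => hv.eqOn hγ hsol, fun x _ => ?_,
    fun Y hY r hr ξ => ?_, fun l t _ => radialProfile_eq_gamma_mul hγ n l t⟩
  · rw [poissonSolution, poissonConst, weightedIntegral]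
    congr 1
    refine integral_congr_ae (Eventually.of_forall fun ξ => ?_)
    simp only [ballPoissonKernel, smul_eq_mul]
    ring
  · have hsum := hY.summable_radialProfile f.continuous hγ hr.1 hr.2 ξ
    refine ⟨hsum, ?_⟩
    have hlim := hY.tendsto_sum_poissonSolution f.continuous hγ (smul_mem_unitBall hr.1 hr.2 ξ)
    simp only [poissonSolution_sphericalHarmonic hγ (hY.mem _) hr.1 hr.2 ξ,
      ← Finset.mul_sum] at hlim
    rw [show (n : ℝ) - (n / 2 + γ) = n / 2 - γ by ring]
    -- The same partial sums converge to `u(rξ)` by `L²` continuity and to the factored series by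
    -- absolute convergence.
    exact tendsto_nhds_unique hlim (hsum.hasSum.tendsto_sum_nat.const_mul _)
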